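/- All graphs are finite and simple. Color the vertices of a set $S \subseteq V(G)$ blue and all other vertices of $G$ white, and apply the following rule as long as possible: if a blue vertex has exactly one white neighbor, that neighbor becomes blue. If eventually all vertices are blue, $S$ is called a zero forcing set; otherwise $S$ is called a failed set. A failed set $S$ is maximal if $S \cup \{v\}$ is not a failed set for every $v \in V(G) \setminus S$, and maximum if no failed set of $G$ has larger cardinality. The graph $G$ is well-failed if every maximal failed set of $G$ is a maximum failed set. A leaf is a vertex of degree one. The graph $G$ is leafy if every vertex that is not a leaf is adjacent to at least two distinct leaves. Let $P_n$ be the path on $n$ vertices, and let $\operatorname{star}_{2,2,2}$ be the tree on seven vertices obtained from the star $K_{1,3}$ by subdividing every edge once. **Theorem.** A tree $T$ is well-failed if and only if at least one of the following holds: $T$ is isomorphic to $P_n$ for some $n \in \{1,2,3,4,6\}$; $T$ is isomorphic to $\operatorname{star}_{2,2,2}$; or $T$ is leafy. -/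

import Mathlib

namespace SimpleGraph

variable {V : Type*}

/-- `G.Forced S v`: the vertex `v` becomes blue when the set `S` is coloured blue and the colour
change rule is applied repeatedly.  The rule: if all neighbours of a blue vertex `u`, except
possibly `v`, are blue, then the neighbour `v` becomes blue. -/
inductive Forced (G : SimpleGraph V) (S : Set V) : V → Prop
  | initial {v : V} (hv : v ∈ S) : Forced G S v
  | force {u v : V} (hu : Forced G S u) (huv : G.Adj u v)
      (hw : ∀ w, G.Adj u w → w ≠ v → Forced G S w) : Forced G S v

/-- The closure of `S`: the set of blue vertices once no more colour changes are possible. -/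
def forcingClosure (G : SimpleGraph V) (S : Set V) : Set V :=
  {v | G.Forced S v}

/-- A zero forcing set: its closure is the whole vertex set. -/
def IsZeroForcingSet (G : SimpleGraph V) (S : Set V) : Prop :=
  G.forcingClosure S = Set.univ

/-- A failed (zero forcing) set: a set of vertices that is not a zero forcing set. -/
def IsFailedSet (G : SimpleGraph V) (S : Set V) : Prop :=
  ¬ G.IsZeroForcingSet S

/-- A maximal failed set: a failed set such that adding any vertex outside it gives a set that is
not failed. -/
def IsMaximalFailedSet (G : SimpleGraph V) (S : Set V) : Prop :=
  G.IsFailedSet S ∧ ∀ v, v ∉ S → ¬ G.IsFailedSet (insert v S)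

/-- A maximum failed set of a finite graph: a failed set of largest cardinality among all failed
sets. -/
def IsMaximumFailedSet (G : SimpleGraph V) (S : Set V) : Prop :=
  G.IsFailedSet S ∧ ∀ S' : Set V, G.IsFailedSet S' → S'.ncard ≤ S.ncard

/-- A (finite) graph is well-failed if every maximal failed set is a maximum failed set. -/
def IsWellFailed (G : SimpleGraph V) : Prop :=
  ∀ S : Set V, G.IsMaximalFailedSet S → G.IsMaximumFailedSet S

/-- A leaf (pendant): a vertex of degree one. -/
def IsPendant (G : SimpleGraph V) (v : V) : Prop :=
  (G.neighborSet v).ncard = 1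

/-- `w` has a double pendant: two distinct pendants have `w` as common neighbour. -/
def HasDoublePendant (G : SimpleGraph V) (w : V) : Prop :=
  ∃ v v' : V, v ≠ v' ∧ G.IsPendant v ∧ G.IsPendant v' ∧ G.Adj w v ∧ G.Adj w v'

/-- A leafy graph: every vertex that is not a leaf has a double pendant. -/
def IsLeafy (G : SimpleGraph V) : Prop :=
  ∀ w : V, ¬ G.IsPendant w → G.HasDoublePendant w

/-- The tree obtained from the star with three edges by subdividing every edge once: the centre is
`0` and the legs are `1 - 2`, `3 - 4` and `5 - 6`. -/
def star222 : SimpleGraph (Fin 7) :=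
  fromEdgeSet {s(0, 1), s(1, 2), s(0, 3), s(3, 4), s(0, 5), s(5, 6)}

end SimpleGraph

/-!
A *fort* is a nonempty set `W` of vertices such that no vertex outside `W` has exactly one neighbour
in `W`.  White vertices that survive the colour change rule form a fort, so a set is failed exactly
when its complement contains a fort, and the maximal failed sets are the complements of the minimal
forts.  Hence a graph is well-failed iff every minimal fort has the least cardinality among all
forts (`isWellFailed_iff`).

In a leafy graph every fort contains a fort with two elements, and no fort is smaller.  The
exceptional paths and `star222` are settled by listing their minimal forts.

Conversely let `T` be a well-failed tree.

* Suppose that some vertex has two pendant neighbours.  These form a fort, so all minimal forts have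
  two elements, and in a tree with at least three vertices such a fort is a pair of twin leaves.  If
  a nonpendant vertex had no double pendant, then deleting all vertices with a double pendant
  together with their leaves, and putting back at most one leaf for each of them, would leave a fort
  without twin leaves (`IsTree.isLeafy_of_hasDoublePendant`).

* Suppose that no vertex has two pendant neighbours.  Then minimal forts can be grown greedily, away
  from a chosen vertex or edge: a pendant child of a member joins the fort, and a nonpendant child
  stays outside and lets exactly one of its own children join (`Fill`).  The result is minimal,
  because membership of one vertex forces that of all the others (`filled_subset_of_isFort`).
  In particular, every vertex of interest lies in a minimal fort.
  Comparing the sizes of such forts shows that a vertex with a pendant neighbour has degree at most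
  two (`IsTree.eq_of_adj_of_isPendant`), and it restricts what follows a pendant path with three
  vertices (`IsTree.exists_isPendant_adj_of_pendant_path`).  Unless `T` has at most two vertices,
  take a vertex `x₁` farthest from a leaf, and let `x₁, x₂, x₃` be the beginning of the path to that
  leaf.  If `x₃` has a pendant neighbour, then `T` is a path with four vertices; if another path of
  length two hangs off `x₃`, then `T` is `star222`; and otherwise `x₃` has degree two and `T` is a
  path with six vertices.
-/

namespace SimpleGraph

variable {V : Type*}

/-! ### Forts and maximal failed sets -/

/-- A fort: a nonempty set `W` of vertices such that no vertex outside `W` has exactly one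
neighbour in `W`. -/
def IsFort (G : SimpleGraph V) (W : Set V) : Prop :=
  W.Nonempty ∧ ∀ ⦃u v : V⦄, u ∉ W → v ∈ W → G.Adj u v → ∃ w ∈ W, w ≠ v ∧ G.Adj u w

/-- The complement of the forcing closure of a failed set is a fort; conversely, no vertex of a
fort can be the first one of the fort to be forced. -/
theorem isFailedSet_iff_exists_isFort {G : SimpleGraph V} {S : Set V} :
    G.IsFailedSet S ↔ ∃ W, G.IsFort W ∧ W ⊆ Sᶜ := by
  constructor
  · intro h
    refine ⟨(G.forcingClosure S)ᶜ, ⟨?_, ?_⟩, ?_⟩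
    · rw [Set.nonempty_compl]
      exact h
    · intro u v hu hv huv
      by_contra! hcon
      refine hv (Forced.force (not_not.mp hu) huv fun w huw hwv => ?_)
      by_contra hw
      exact hcon w hw hwv huw
    · exact Set.compl_subset_compl.mpr fun v hv => Forced.initial hv
  · rintro ⟨W, ⟨⟨x, hx⟩, hW⟩, hWS⟩ h
    have key : ∀ v, G.Forced S v → v ∉ W := by
      intro v hv
      induction hv with
      | initial hv => exact fun hw => hWS hw hv
      | force hu huv hw ihu ihw =>
        intro hvW
        obtain ⟨w, hwW, hwv, huw⟩ := hW ihu hvW huv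
        exact ihw w huw hwv hwW
    have hx' : x ∈ G.forcingClosure S := h ▸ Set.mem_univ x
    exact key x hx' hx

theorem isMaximalFailedSet_iff_minimal_isFort_compl {G : SimpleGraph V} {S : Set V} :
    G.IsMaximalFailedSet S ↔ Minimal G.IsFort Sᶜ := by
  constructor
  · rintro ⟨hS, hmax⟩
    have key : ∀ W, G.IsFort W → W ⊆ Sᶜ → Sᶜ ⊆ W := by
      intro W hW hWS v hv
      by_contra hvW
      refine hmax v hv (isFailedSet_iff_exists_isFort.mpr ⟨W, hW, fun w hw => ?_⟩)
      rintro (rfl | h)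
      · exact hvW hw
      · exact hWS hw h
    obtain ⟨W, hW, hWS⟩ := isFailedSet_iff_exists_isFort.mp hS
    have : W = Sᶜ := hWS.antisymm (key W hW hWS)
    exact ⟨this ▸ hW, fun W' hW' h => key W' hW' h⟩
  · rintro ⟨hS, hmin⟩
    refine ⟨isFailedSet_iff_exists_isFort.mpr ⟨_, hS, subset_rfl⟩, fun v hv hfail => ?_⟩
    obtain ⟨W, hW, hWS⟩ := isFailedSet_iff_exists_isFort.mp hfail
    have h1 : W ⊆ Sᶜ := hWS.trans (Set.compl_subset_compl.mpr (Set.subset_insert v S))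
    exact hWS (hmin hW h1 hv) (Set.mem_insert v S)

theorem isWellFailed_iff [Finite V] {G : SimpleGraph V} :
    G.IsWellFailed ↔
      ∀ W, Minimal G.IsFort W → ∀ W', G.IsFort W' → W.ncard ≤ W'.ncard := by
  constructor
  · intro h W hW W' hW'
    have h1 : G.IsMaximumFailedSet Wᶜ :=
      h _ (isMaximalFailedSet_iff_minimal_isFort_compl.mpr (by rwa [compl_compl]))
    have h2 := h1.2 W'ᶜ (isFailedSet_iff_exists_isFort.mpr ⟨W', hW', by rw [compl_compl]⟩)
    have h3 := Set.ncard_add_ncard_compl W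
    have h4 := Set.ncard_add_ncard_compl W'
    omega
  · intro h S hS
    refine ⟨hS.1, fun S' hS' => ?_⟩
    obtain ⟨W', hW', hWS'⟩ := isFailedSet_iff_exists_isFort.mp hS'
    have h2 := h _ (isMaximalFailedSet_iff_minimal_isFort_compl.mp hS) W' hW'
    have h3 := Set.ncard_add_ncard_compl S
    have h4 := Set.ncard_add_ncard_compl S'
    have h5 := Set.ncard_le_ncard hWS'
    omega

theorem IsFort.exists_minimal_subset [Finite V] {G : SimpleGraph V} {W : Set V}
    (hW : G.IsFort W) : ∃ F ⊆ W, Minimal G.IsFort F :=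
  (Set.toFinite {F | G.IsFort F}).exists_le_minimal hW

/-! ### Pendant vertices -/

theorem IsPendant.eq {G : SimpleGraph V} {l u w : V} (hl : G.IsPendant l) (hu : G.Adj l u)
    (hw : G.Adj l w) : u = w := by
  obtain ⟨a, ha⟩ := Set.ncard_eq_one.mp hl
  have h1 : u ∈ ({a} : Set V) := ha ▸ hu
  have h2 : w ∈ ({a} : Set V) := ha ▸ hw
  exact h1.trans h2.symm

theorem isPendant_of_forall_eq {G : SimpleGraph V} {l u : V} (hu : G.Adj l u)
    (h : ∀ w, G.Adj l w → w = u) : G.IsPendant l := by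
  refine Set.ncard_eq_one.mpr ⟨u, Set.ext fun w => ⟨fun hw => h w hw, ?_⟩⟩
  rintro rfl
  exact hu

theorem exists_adj_ne_of_not_isPendant {G : SimpleGraph V} {d v : V} (hd : ¬ G.IsPendant d)
    (hv : G.Adj d v) : ∃ e, G.Adj d e ∧ e ≠ v := by
  by_contra! h
  exact hd (isPendant_of_forall_eq hv h)

theorem IsFort.mem_of_isPendant {G : SimpleGraph V} {W : Set V} (hW : G.IsFort W) {v l : V}
    (hv : v ∈ W) (hl : G.IsPendant l) (hvl : G.Adj v l) : l ∈ W := by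
  by_contra hlW
  obtain ⟨w, -, hwv, hw⟩ := hW.2 hlW hv hvl.symm
  exact hwv (hl.eq hw hvl.symm)

/-! ### Rooted trees -/

/-- `G.IsParent r p v`: the vertex `p` precedes `v` on a shortest walk from the root `r`, so in a
tree `p` is the parent of `v`. -/
def IsParent (G : SimpleGraph V) (r p v : V) : Prop :=
  G.Adj p v ∧ G.dist r v = G.dist r p + 1

theorem IsAcyclic.walk_eq_of_isPath {G : SimpleGraph V} (hG : G.IsAcyclic) {u v : V}
    {p q : G.Walk u v} (hp : p.IsPath) (hq : q.IsPath) : p = q :=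
  congrArg Subtype.val ((hG.subsingleton_path u v).elim ⟨p, hp⟩ ⟨q, hq⟩)

theorem IsTree.length_eq_dist {G : SimpleGraph V} (hG : G.IsTree) {u v : V} {p : G.Walk u v}
    (hp : p.IsPath) : p.length = G.dist u v := by
  obtain ⟨q, hq, hl⟩ := hG.1.exists_path_of_dist u v
  rw [← hl, hG.2.walk_eq_of_isPath hp hq]

theorem IsParent.eq {G : SimpleGraph V} (hG : G.IsTree) {r p p' v : V}
    (h : G.IsParent r p v) (h' : G.IsParent r p' v) : p = p' := by
  obtain ⟨q, hq, hl⟩ := hG.1.exists_path_of_dist r p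
  obtain ⟨q', hq', hl'⟩ := hG.1.exists_path_of_dist r p'
  have h1 : (q.concat h.1).IsPath := Walk.isPath_of_length_eq_dist _ (by
    rw [Walk.length_concat, hl, h.2])
  have h2 : (q'.concat h'.1).IsPath := Walk.isPath_of_length_eq_dist _ (by
    rw [Walk.length_concat, hl', h'.2])
  have h3 : q.concat h.1 = q'.concat h'.1 :=
    hG.2.walk_eq_of_isPath h1 h2
  have := congrArg Walk.penultimate h3
  simpa using this

/-- In a rooted tree every neighbour of `v` other than its parent is a child of `v`. -/
theorem IsParent.child {G : SimpleGraph V} (hG : G.IsTree) {r p v d : V}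
    (h : G.IsParent r p v) (hd : G.Adj v d) (hne : d ≠ p) : G.IsParent r v d := by
  classical
  obtain ⟨q, hq, hl⟩ := hG.1.exists_path_of_dist r v
  have hdq : d ∉ q.support := by
    intro hdq
    have h1 : G.dist r d ≤ (q.takeUntil d hdq).length := dist_le _
    have h2 := q.length_takeUntil_le_length hdq
    have h3 : (q.takeUntil d hdq).length ≠ q.length := fun h3 => hd.ne' (by
      have := Walk.eq_of_length_eq_zero (p := q.dropUntil d hdq) (by
        have := congrArg Walk.length (q.take_spec hdq)
        rw [Walk.length_append] at this
        omega)
      exact this)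
    have h4 := hG.1.dist_triangle (u := r) (v := d) (w := v)
    rw [dist_eq_one_iff_adj.mpr hd.symm] at h4
    exact hne (IsParent.eq hG ⟨hd.symm, by omega⟩ h)
  have hp : (q.concat hd).IsPath := hq.concat hdq hd
  refine ⟨hd, ?_⟩
  rw [← hG.length_eq_dist hp, ← hl, Walk.length_concat]

theorem isParent_root {G : SimpleGraph V} {r v : V} (h : G.Adj r v) : G.IsParent r r v :=
  ⟨h, by rw [dist_self, dist_eq_one_iff_adj.mpr h]⟩

theorem not_isParent_root {G : SimpleGraph V} {r p : V} : ¬ G.IsParent r p r := by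
  rintro ⟨-, h⟩
  rw [dist_self] at h
  omega

theorem Connected.exists_isParent {G : SimpleGraph V} (hG : G.Connected) {r v : V} (h : v ≠ r) :
    ∃ p, G.IsParent r p v := by
  obtain ⟨q, hq, hl⟩ := hG.exists_path_of_dist r v
  have hnil : ¬ q.Nil := Walk.not_nil_of_ne h.symm
  refine ⟨q.penultimate, q.adj_penultimate hnil, ?_⟩
  have h1 : G.dist r q.penultimate ≤ q.dropLast.length := dist_le _
  have h2 := hG.dist_triangle (u := r) (v := q.penultimate) (w := v)
  rw [dist_eq_one_iff_adj.mpr (q.adj_penultimate hnil)] at h2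
  have h3 : q.dropLast.length + 1 = q.length := by
    have := Walk.not_nil_iff_lt_length.mp hnil
    rw [Walk.length_dropLast]
    omega
  omega

/-! ### Growing minimal forts -/

/-- `Par p v` orients edges of `G` from `p` to `v`, away from some centre: a vertex has at most
one predecessor, and every further neighbour of a vertex with a predecessor is a successor of it.
An edge may be oriented in both directions, so that the centre can be an edge or a vertex. -/
structure IsOutward (G : SimpleGraph V) (Par : V → V → Prop) : Prop where
  adj : ∀ {p v}, Par p v → G.Adj p v
  unique : ∀ {p p' v}, Par p v → Par p' v → p = p'
  child : ∀ {p v d}, Par p v → G.Adj v d → d ≠ p → Par v d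

theorem IsTree.isOutward_isParent {G : SimpleGraph V} (hG : G.IsTree) (r : V) :
    G.IsOutward (G.IsParent r) where
  adj h := h.1
  unique h h' := h.eq hG h'
  child h hd hne := h.child hG hd hne

/-- `G.Fill Base ch p v`: the vertex `v`, reached from its neighbour `p`, is put into the set grown
from the pairs in `Base`.  When `v` is a member, its further pendant neighbours become members,
and for each further nonpendant neighbour `d`, the vertex `ch v d` becomes a member. -/
inductive Fill (G : SimpleGraph V) (Base : V → V → Prop) (ch : V → V → V) : V → V → Prop
  | base {p v : V} (h : Base p v) : Fill G Base ch p v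
  | leaf {p v l : V} (h : Fill G Base ch p v) (hvl : G.Adj v l) (hlp : l ≠ p)
      (hl : G.IsPendant l) : Fill G Base ch v l
  | step {p v d : V} (h : Fill G Base ch p v) (hvd : G.Adj v d) (hdp : d ≠ p)
      (hd : ¬ G.IsPendant d) : Fill G Base ch d (ch v d)

/-- `ch v d` is a neighbour of `d` other than `v`, for every nonpendant neighbour `d` of `v`. -/
def IsChoice (G : SimpleGraph V) (ch : V → V → V) : Prop :=
  ∀ ⦃v d : V⦄, G.Adj v d → ¬ G.IsPendant d → G.Adj d (ch v d) ∧ ch v d ≠ v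

theorem exists_isChoice (G : SimpleGraph V) : ∃ ch, G.IsChoice ch := by
  have h : ∀ v d : V, ∃ e, G.Adj v d → ¬ G.IsPendant d → G.Adj d e ∧ e ≠ v := by
    intro v d
    by_cases hvd : G.Adj v d
    · by_cases hd : G.IsPendant d
      · exact ⟨v, fun _ h => absurd hd h⟩
      · obtain ⟨e, he⟩ := exists_adj_ne_of_not_isPendant hd hvd.symm
        exact ⟨e, fun _ _ => he⟩
    · exact ⟨v, fun h => absurd h hvd⟩
  choose ch hch using h
  exact ⟨ch, hch⟩

/-- The set of vertices grown from the pairs in `Base`. -/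
def filled (G : SimpleGraph V) (Base : V → V → Prop) (ch : V → V → V) : Set V :=
  {v | ∃ p, G.Fill Base ch p v}

section Fill

variable {G : SimpleGraph V} {Par Base : V → V → Prop} {ch : V → V → V}

theorem Fill.par (hP : G.IsOutward Par) (hch : G.IsChoice ch) (hB : ∀ p v, Base p v → Par p v)
    {p v : V} (h : G.Fill Base ch p v) : Par p v := by
  induction h with
  | base h => exact hB _ _ h
  | leaf h hvl hlp hl ih => exact hP.child ih hvl hlp
  | step h hvd hdp hd ih =>
    exact hP.child (hP.child ih hvd hdp) (hch hvd hd).1 (hch hvd hd).2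

/-- A nonpendant neighbour that follows a member is not a member itself.  The hypothesis `hB'`
says that a pair of `Base` starts in a vertex without predecessor, or is the reverse of an oriented
edge. -/
theorem Fill.not_mem_of_not_isPendant (hP : G.IsOutward Par) (hch : G.IsChoice ch)
    (hB : ∀ p v, Base p v → Par p v) (hB' : ∀ p v d, Base v d → Par p v → p = d)
    {p v d : V} (h : G.Fill Base ch p v) (hvd : G.Adj v d) (hdp : d ≠ p)
    (hd : ¬ G.IsPendant d) : d ∉ G.filled Base ch := by
  have key : ∀ {p v : V}, G.Fill Base ch p v → ∀ d, G.Adj v d → d ≠ p → ¬ G.IsPendant d →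
      ¬ G.Fill Base ch v d := by
    intro p v h
    induction h with
    | @base p v h =>
      intro d hvd hdp hd hf
      cases hf with
      | base h' => exact hdp (hB' _ _ _ h' (hB _ _ h)).symm
      | leaf _ _ _ hl => exact hd hl
      | @step p'' u _ hu huv hvp'' hv =>
        have hup : u = p :=
          hP.unique (hP.child (hu.par hP hch hB) huv hvp'') (hB _ _ h)
        subst hup
        exact hvp'' (hB' _ _ _ h (hu.par hP hch hB)).symm
    | @leaf p v l h hvl hlp hl ih =>
      intro d hld hdv _ _
      exact hdv (hl.eq hld hvl.symm)
    | @step p u d0 h hud hdp0 hd0 ih =>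
      intro d hvd hdp hd hf
      have hpar : Par d0 (ch u d0) := (Fill.step h hud hdp0 hd0).par hP hch hB
      have hpar0 : Par u d0 := hP.child (h.par hP hch hB) hud hdp0
      have hmem : G.Fill Base ch u d0 → False := ih d0 hud hdp0 hd0
      generalize hw : ch u d0 = w at hf hpar hvd
      cases hf with
      | base h' => exact hdp (hB' _ _ _ h' hpar).symm
      | leaf _ _ _ hl => exact hd hl
      | @step p'' u' _ hu' huv' hvp'' hv =>
        have h1 : u' = d0 := hP.unique (hP.child (hu'.par hP hch hB) huv' hvp'') hpar
        subst h1
        have h2 : p'' = u := hP.unique (hu'.par hP hch hB) hpar0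
        subst h2
        exact hmem hu'
  rintro ⟨p', hf⟩
  have h1 : p' = v := hP.unique (hf.par hP hch hB) (hP.child (h.par hP hch hB) hvd hdp)
  subst h1
  exact key h d hvd hdp hd hf

/-- The grown set is a fort in any graph; no acyclicity is involved.  By `hroot`, a starting
vertex outside the set must have a second neighbour in it. -/
theorem isFort_filled (hch : G.IsChoice ch) (hne : ∃ p v, Base p v)
    (hroot : ∀ p v, Base p v → p ∈ G.filled Base ch ∨ ∃ w, Base p w ∧ w ≠ v)
    (hB : ∀ p v, Base p v → G.Adj p v) :
    G.IsFort (G.filled Base ch) := by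
  obtain ⟨p, v, h⟩ := hne
  refine ⟨⟨v, p, .base h⟩, ?_⟩
  rintro w v hw ⟨p, hv⟩ hwv
  by_cases hwp : w = p
  · subst hwp
    cases hv with
    | base h =>
      obtain h1 | ⟨y, hy, hyv⟩ := hroot _ _ h
      · exact absurd h1 hw
      · exact ⟨y, ⟨w, .base hy⟩, hyv, hB _ _ hy⟩
    | leaf h _ _ _ => exact absurd ⟨_, h⟩ hw
    | @step p v _ h hvd hdp hd =>
      exact ⟨v, ⟨p, h⟩, (hch hvd hd).2.symm, hvd.symm⟩
  · by_cases hl : G.IsPendant w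
    · exact absurd ⟨v, .leaf hv hwv.symm hwp hl⟩ hw
    · obtain ⟨h1, h2⟩ := hch hwv.symm hl
      exact ⟨ch v w, ⟨w, .step hv hwv.symm hwp hl⟩, h2, h1⟩

/-- Minimality of the grown set: let `F` be a fort inside it.  Membership in `F` passes from
each member to its predecessor member, because the vertex between them has no third neighbour in
the set, and in the same way back down; `hlink` connects the different starting pairs.
By `hB2`, the ends of a central edge have no pendant neighbours. -/
theorem filled_subset_of_isFort (hG : ∀ w, ¬ G.HasDoublePendant w)
    (hP : G.IsOutward Par) (hch : G.IsChoice ch)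
    (hB : ∀ p v, Base p v → Par p v) (hB' : ∀ p v d, Base v d → Par p v → p = d)
    (hB2 : ∀ p v l, Par p v → Par v p → G.Adj v l → ¬ G.IsPendant l)
    {F : Set V} (hF : G.IsFort F) (hFX : F ⊆ G.filled Base ch)
    (hlink : ∀ p v p' v', Base p v → Base p' v' → v ∈ F → v' ∈ F) :
    G.filled Base ch ⊆ F := by
  -- A nonpendant child `d` of a member `v` has no neighbours in `F` besides `v` and `ch v d`.
  have hout : ∀ {p v d y : V}, G.Fill Base ch p v → G.Adj v d → d ≠ p → ¬ G.IsPendant d →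
      y ∈ F → G.Adj d y → y = v ∨ y = ch v d := by
    intro p v d y h hvd hdp hd hy hdy
    by_contra! hcon
    obtain ⟨p', hf⟩ := hFX hy
    have hvd' : Par v d := hP.child (h.par hP hch hB) hvd hdp
    have hp' : p' = d := hP.unique (hf.par hP hch hB) (hP.child hvd' hdy hcon.1)
    have hdX := h.not_mem_of_not_isPendant hP hch hB hB' hvd hdp hd
    subst hp'
    cases hf with
    | base h' => exact hcon.1 (hB' _ _ _ h' hvd').symm
    | leaf h' _ _ _ => exact hdX ⟨_, h'⟩
    | @step p'' u _ h' hud hdp'' hd' =>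
      have : u = v := hP.unique (hP.child (h'.par hP hch hB) hud hdp'') hvd'
      subst this
      exact hcon.2 rfl
  have hup : ∀ {p v : V}, G.Fill Base ch p v → v ∈ F → ∃ p' v', Base p' v' ∧ v' ∈ F := by
    intro p v h
    induction h with
    | base h => exact fun hv => ⟨_, _, h, hv⟩
    | @leaf p v l h hvl hlp hl ih =>
      intro hlF
      by_contra hcon
      have hvF : v ∉ F := fun hv => hcon (ih hv)
      obtain ⟨y, hyF, hyl, hvy⟩ := hF.2 hvF hlF hvl
      have hyp : ¬ G.IsPendant y := fun hy => hG v ⟨y, l, hyl, hy, hl, hvy, hvl⟩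
      by_cases hy : y = p
      · subst hy
        obtain ⟨p', hf⟩ := hFX hyF
        have hvp : v = p' := by
          by_contra hne
          exact hf.not_mem_of_not_isPendant hP hch hB hB' hvy.symm hne
            (fun hv => hlp (hv.eq hvl hvy)) ⟨_, h⟩
        subst hvp
        exact hB2 _ _ _ (h.par hP hch hB) (hf.par hP hch hB) hvl hl
      · exact h.not_mem_of_not_isPendant hP hch hB hB' hvy hy hyp (hFX hyF)
    | @step p v d h hvd hdp hd ih =>
      intro hcF
      have hdF : d ∉ F := fun hdF =>
        h.not_mem_of_not_isPendant hP hch hB hB' hvd hdp hd (hFX hdF)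
      obtain ⟨y, hyF, hyc, hdy⟩ := hF.2 hdF hcF (hch hvd hd).1
      obtain rfl | rfl := hout h hvd hdp hd hyF hdy
      · exact ih hyF
      · exact absurd rfl hyc
  obtain ⟨x, hx⟩ := hF.1
  obtain ⟨p, hpx⟩ := hFX hx
  obtain ⟨p0, v0, h0, hv0⟩ := hup hpx hx
  rintro v ⟨p, h⟩
  induction h with
  | base h => exact hlink _ _ _ _ h0 h hv0
  | leaf h hvl hlp hl ih => exact hF.mem_of_isPendant ih hl hvl
  | @step p v d h hvd hdp hd ih =>
    have hdF : d ∉ F := fun hdF =>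
      h.not_mem_of_not_isPendant hP hch hB hB' hvd hdp hd (hFX hdF)
    obtain ⟨y, hyF, hyv, hdy⟩ := hF.2 hdF ih hvd.symm
    obtain rfl | rfl := hout h hvd hdp hd hyF hdy
    · exact absurd rfl hyv
    · exact hyF

end Fill

/-- Growing from two neighbours `a`, `b` of a vertex `r` that stays outside gives a minimal fort. -/
theorem IsTree.minimal_isFort_filled {G : SimpleGraph V} (hT : G.IsTree)
    (hG : ∀ w, ¬ G.HasDoublePendant w) {ch : V → V → V} (hch : G.IsChoice ch) {r a b : V}
    (ha : G.Adj r a) (hb : G.Adj r b) (hab : a ≠ b) :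
    Minimal G.IsFort (G.filled (fun p v => p = r ∧ (v = a ∨ v = b)) ch) ∧
      r ∉ G.filled (fun p v => p = r ∧ (v = a ∨ v = b)) ch := by
  set Base : V → V → Prop := fun p v => p = r ∧ (v = a ∨ v = b) with hBase
  have hP := hT.isOutward_isParent r
  have hB : ∀ p v, Base p v → G.IsParent r p v := by
    rintro p v ⟨rfl, rfl | rfl⟩
    · exact isParent_root ha
    · exact isParent_root hb
  have hB' : ∀ p v d, Base v d → G.IsParent r p v → p = d := by
    rintro p v d ⟨rfl, -⟩ h
    exact absurd h not_isParent_root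
  have hr : r ∉ G.filled Base ch := fun ⟨p, hp⟩ => not_isParent_root (hp.par hP hch hB)
  have hne : ∀ c, c = a ∨ c = b → ∃ c', (c' = a ∨ c' = b) ∧ c' ≠ c ∧
      ∀ x, x = a ∨ x = b → x = c ∨ x = c' := by
    rintro c (rfl | rfl)
    · exact ⟨b, .inr rfl, hab.symm, by tauto⟩
    · exact ⟨a, .inl rfl, hab, by tauto⟩
  refine ⟨⟨isFort_filled hch ⟨r, a, rfl, .inl rfl⟩ ?_ fun p v h => (hB p v h).1, ?_⟩, hr⟩
  · rintro p v ⟨rfl, hv⟩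
    obtain ⟨c', hc', hne', -⟩ := hne v hv
    exact .inr ⟨c', ⟨rfl, hc'⟩, hne'⟩
  · intro F hF hFX
    refine filled_subset_of_isFort hG hP hch hB hB' ?_ hF hFX ?_
    · rintro p v l ⟨-, h⟩ ⟨-, h'⟩
      omega
    · rintro p v p' v' ⟨-, hv⟩ ⟨-, hv'⟩ hvF
      have hcase : ∀ {x}, G.Adj r x → x ∈ F → x = a ∨ x = b := by
        intro x hpx hx
        obtain ⟨q, hq⟩ := hFX hx
        have h1 : q = r := hP.unique (hq.par hP hch hB) (isParent_root hpx)
        subst h1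
        cases hq with
        | base h => exact h.2
        | leaf h _ _ _ => exact absurd ⟨_, h⟩ hr
        | step h hvd hdp hd =>
          exact absurd (hP.child (h.par hP hch hB) hvd hdp) not_isParent_root
      obtain ⟨y, hyF, hyv, hpy⟩ := hF.2 (fun h => hr (hFX h)) hvF (hB _ v ⟨rfl, hv⟩).1
      obtain ⟨c', hc', hne', hall⟩ := hne v hv
      obtain rfl | rfl := hall v' hv'
      · exact hvF
      · obtain h | h := hall y (hcase hpy hyF)
        · exact absurd h hyv
        · exact h ▸ hyF

/-- Growing from both ends of an edge gives a minimal fort, if these ends have no pendant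
neighbours. -/
theorem IsTree.minimal_isFort_filled_edge {G : SimpleGraph V} (hT : G.IsTree)
    (hG : ∀ w, ¬ G.HasDoublePendant w) {ch : V → V → V} (hch : G.IsChoice ch) {a b : V}
    (hab : G.Adj a b) (ha : ∀ l, G.Adj a l → ¬ G.IsPendant l)
    (hb : ∀ l, G.Adj b l → ¬ G.IsPendant l) :
    Minimal G.IsFort (G.filled (fun p v => p = a ∧ v = b ∨ p = b ∧ v = a) ch) := by
  set Base : V → V → Prop := fun p v => p = a ∧ v = b ∨ p = b ∧ v = a with hBase
  set Par : V → V → Prop := fun p v => G.IsParent a p v ∨ p = b ∧ v = a with hPar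
  have hP' := hT.isOutward_isParent a
  have hP : G.IsOutward Par := by
    refine ⟨?_, ?_, ?_⟩
    · rintro p v (h | ⟨rfl, rfl⟩)
      exacts [h.1, hab.symm]
    · rintro p p' v (h | ⟨rfl, rfl⟩) (h' | ⟨rfl, h'⟩)
      · exact hP'.unique h h'
      · exact absurd (h' ▸ h) not_isParent_root
      · exact absurd h' not_isParent_root
      · rfl
    · rintro p v d (h | ⟨rfl, rfl⟩) hvd hdp
      · exact .inl (hP'.child h hvd hdp)
      · exact .inl (isParent_root hvd)
  have hB : ∀ p v, Base p v → Par p v := by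
    rintro p v (⟨rfl, rfl⟩ | h)
    · exact .inl (isParent_root hab)
    · exact .inr h
  -- The edge `a b` is oriented in both directions, so `a` and `b` are each other's predecessors.
  have hB' : ∀ p v d, Base v d → Par p v → p = d := by
    rintro p v d (⟨rfl, rfl⟩ | ⟨rfl, rfl⟩) h
    · exact hP.unique h (.inr ⟨rfl, rfl⟩)
    · exact hP.unique h (.inl (isParent_root hab))
  have hmem : ∀ {p v}, Base p v → p ∈ G.filled Base ch := by
    rintro p v (⟨rfl, rfl⟩ | ⟨rfl, rfl⟩)
    · exact ⟨v, .base (.inr ⟨rfl, rfl⟩)⟩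
    · exact ⟨v, .base (.inl ⟨rfl, rfl⟩)⟩
  refine ⟨isFort_filled hch ⟨a, b, .inl ⟨rfl, rfl⟩⟩ (fun p v h => .inl (hmem h))
    fun p v h => hP.adj (hB p v h), ?_⟩
  intro F hF hFX
  refine filled_subset_of_isFort hG hP hch hB hB' ?_ hF hFX ?_
  · rintro p v l (⟨h1, h⟩ | ⟨rfl, rfl⟩) (⟨-, h'⟩ | ⟨h2, h3⟩)
    · omega
    · subst h2 h3
      exact hb l
    · exact ha l
    · exact absurd h2 hab.ne
  · have key : ∀ {v v'}, Base v' v → v ∈ F → v' ∈ F := by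
      intro v v' h hv
      have h' : Base v v' := h.elim (fun h => .inr ⟨h.2, h.1⟩) fun h => .inl ⟨h.2, h.1⟩
      have hl : ∀ l, G.Adj v' l → ¬ G.IsPendant l := by
        obtain ⟨rfl, rfl⟩ | ⟨rfl, rfl⟩ := h
        exacts [ha, hb]
      by_contra hv'
      obtain ⟨y, hyF, hyv, hy⟩ := hF.2 hv' hv (hP.adj (hB _ _ h))
      exact (Fill.base h').not_mem_of_not_isPendant hP hch hB hB' hy hyv (hl y hy) (hFX hyF)
    rintro p v p' v' (⟨rfl, rfl⟩ | ⟨rfl, rfl⟩) (⟨rfl, rfl⟩ | ⟨rfl, rfl⟩) hv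
    · exact hv
    · exact key (.inl ⟨rfl, rfl⟩) hv
    · exact key (.inr ⟨rfl, rfl⟩) hv
    · exact hv

/-! ### Comparing the sizes of grown forts -/

theorem Fill.mono {G : SimpleGraph V} {Base Base' : V → V → Prop} {ch : V → V → V}
    (hBase : ∀ p v, Base p v → Base' p v) {p v : V} (h : G.Fill Base ch p v) :
    G.Fill Base' ch p v := by
  induction h with
  | base h => exact .base (hBase _ _ h)
  | leaf _ hvl hlp hl ih => exact .leaf ih hvl hlp hl
  | step _ hvd hdp hd ih => exact .step ih hvd hdp hd

theorem Fill.or {G : SimpleGraph V} {Base Base' : V → V → Prop} {ch : V → V → V} {p v : V}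
    (h : G.Fill (fun p v => Base p v ∨ Base' p v) ch p v) :
    G.Fill Base ch p v ∨ G.Fill Base' ch p v := by
  induction h with
  | base h => exact h.imp .base .base
  | leaf _ hvl hlp hl ih =>
    exact ih.imp (fun h => .leaf h hvl hlp hl) (fun h => .leaf h hvl hlp hl)
  | step _ hvd hdp hd ih =>
    exact ih.imp (fun h => .step h hvd hdp hd) (fun h => .step h hvd hdp hd)

theorem IsTree.exists_minimal_isFort_of_adj_of_adj {G : SimpleGraph V} (hT : G.IsTree)
    (hG : ∀ w, ¬ G.HasDoublePendant w) {r a b : V}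
    (ha : G.Adj r a) (hb : G.Adj r b) (hab : a ≠ b) :
    ∃ F, Minimal G.IsFort F ∧ a ∈ F ∧ b ∈ F ∧ r ∉ F := by
  obtain ⟨ch, hch⟩ := G.exists_isChoice
  obtain ⟨h1, h2⟩ := hT.minimal_isFort_filled hG hch ha hb hab
  exact ⟨_, h1, ⟨r, .base ⟨rfl, .inl rfl⟩⟩, ⟨r, .base ⟨rfl, .inr rfl⟩⟩, h2⟩

theorem IsTree.exists_minimal_isFort_mem {G : SimpleGraph V} (hT : G.IsTree)
    (hG : ∀ w, ¬ G.HasDoublePendant w) {v w : V} (hvw : G.Adj v w) (hw : ¬ G.IsPendant w) :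
    ∃ F, Minimal G.IsFort F ∧ v ∈ F := by
  obtain ⟨u, hu, huv⟩ := exists_adj_ne_of_not_isPendant hw hvw.symm
  obtain ⟨F, hF, h, -⟩ := hT.exists_minimal_isFort_of_adj_of_adj hG hvw.symm hu huv.symm
  exact ⟨F, hF, h⟩

theorem IsTree.disjoint_filled {G : SimpleGraph V} (hT : G.IsTree)
    {ch : V → V → V} (hch : G.IsChoice ch) {r a b : V}
    (ha : G.Adj r a) (hb : G.Adj r b) (hab : a ≠ b) :
    Disjoint (G.filled (fun p v => p = r ∧ v = a) ch)
      (G.filled (fun p v => p = r ∧ v = b) ch) := by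
  have hP := hT.isOutward_isParent r
  have hB : ∀ p v, (p = r ∧ (v = a ∨ v = b)) → G.IsParent r p v := by
    rintro p v ⟨rfl, rfl | rfl⟩
    · exact isParent_root ha
    · exact isParent_root hb
  have hB' : ∀ p v d, (v = r ∧ (d = a ∨ d = b)) → G.IsParent r p v → p = d := by
    rintro p v d ⟨rfl, -⟩ h
    exact absurd h not_isParent_root
  have hA : ∀ {p v}, G.Fill (fun p v => p = r ∧ v = a) ch p v →
      G.Fill (fun p v => p = r ∧ (v = a ∨ v = b)) ch p v :=
    fun h => h.mono fun p v h => ⟨h.1, .inl h.2⟩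
  have hC : ∀ {p v}, G.Fill (fun p v => p = r ∧ v = b) ch p v →
      G.Fill (fun p v => p = r ∧ (v = a ∨ v = b)) ch p v :=
    fun h => h.mono fun p v h => ⟨h.1, .inr h.2⟩
  have key : ∀ {p v}, G.Fill (fun p v => p = r ∧ v = a) ch p v →
      ¬ G.Fill (fun p v => p = r ∧ v = b) ch p v := by
    intro p v h
    induction h with
    | base h =>
      obtain ⟨rfl, rfl⟩ := h
      intro h
      cases h with
      | base h => exact hab h.2
      | leaf h _ _ _ => exact not_isParent_root ((hC h).par hP hch hB)
      | step h hvd hdp hd =>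
        exact not_isParent_root (hP.child ((hC h).par hP hch hB) hvd hdp)
    | @leaf p v l h hvl hlp hl ih =>
      intro h'
      have hpar := (hA h).par hP hch hB
      cases h' with
      | base h' =>
        rw [h'.1] at hpar
        exact not_isParent_root hpar
      | @leaf p' _ _ h' _ _ _ =>
        have : p' = p := hP.unique ((hC h').par hP hch hB) hpar
        exact ih (this ▸ h')
      | @step p' u _ h' huv hvp' hv =>
        have : u = p := hP.unique (hP.child ((hC h').par hP hch hB) huv hvp') hpar
        subst this
        exact (hC h').not_mem_of_not_isPendant hP hch hB hB' huv hvp' hv ⟨_, hA h⟩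
    | @step p v d h hvd hdp hd ih =>
      intro h'
      have hpar := (hA h).par hP hch hB
      have hpard : G.IsParent r v d := hP.child hpar hvd hdp
      generalize ch v d = c at h'
      cases h' with
      | base h' =>
        rw [h'.1] at hpard
        exact not_isParent_root hpard
      | leaf h' _ _ _ =>
        exact (hA h).not_mem_of_not_isPendant hP hch hB hB' hvd hdp hd ⟨_, hC h'⟩
      | @step p' u _ h' hud hdp' hd' =>
        have : u = v := hP.unique (hP.child ((hC h').par hP hch hB) hud hdp') hpard
        subst this
        have : p' = p := hP.unique ((hC h').par hP hch hB) hpar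
        exact ih (this ▸ h')
  rw [Set.disjoint_left]
  rintro v ⟨p, h⟩ ⟨p', h'⟩
  have : p' = p := hP.unique ((hC h').par hP hch hB) ((hA h).par hP hch hB)
  exact key h (this ▸ h')

/-- A vertex `r` with a pendant neighbour `z` has at most one other neighbour.  Otherwise let `A`
and `B` be the disjoint sets grown from two other neighbours.  Then `A ∪ B` is a minimal fort and
`{z} ∪ B` is a fort, but `A` has at least two elements. -/
theorem IsTree.eq_of_adj_of_isPendant [Finite V] {G : SimpleGraph V} (hT : G.IsTree)
    (hG : ∀ w, ¬ G.HasDoublePendant w)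
    (hW : ∀ W, Minimal G.IsFort W → ∀ W', G.IsFort W' → W.ncard ≤ W'.ncard)
    {r z a b : V} (hz : G.IsPendant z) (hrz : G.Adj r z) (ha : G.Adj r a) (hb : G.Adj r b)
    (haz : a ≠ z) (hbz : b ≠ z) : a = b := by
  by_contra hab
  obtain ⟨ch, hch⟩ := G.exists_isChoice
  have hF := (hT.minimal_isFort_filled hG hch ha hb hab).1
  have hF' := (hT.minimal_isFort_filled hG hch hrz hb hbz.symm).1.1
  have hle := hW _ hF _ hF'
  have hdisj := hT.disjoint_filled hch ha hb hab
  set A := G.filled (fun p v => p = r ∧ v = a) ch with hA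
  set B := G.filled (fun p v => p = r ∧ v = b) ch with hB
  have h1 : A ∪ B ⊆ G.filled (fun p v => p = r ∧ (v = a ∨ v = b)) ch := by
    rintro v (⟨p, h⟩ | ⟨p, h⟩)
    · exact ⟨p, h.mono fun p v h => ⟨h.1, .inl h.2⟩⟩
    · exact ⟨p, h.mono fun p v h => ⟨h.1, .inr h.2⟩⟩
  have h2 : G.filled (fun p v => p = r ∧ (v = z ∨ v = b)) ch ⊆ insert z B := by
    rintro v ⟨p, h⟩
    have hz' : ∀ {p v}, G.Fill (fun p v => p = r ∧ v = z) ch p v → p = r ∧ v = z := by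
      intro p v h
      induction h with
      | base h => exact h
      | leaf _ hvl hlp _ ih =>
        obtain ⟨rfl, rfl⟩ := ih
        exact absurd (hz.eq hvl hrz.symm) hlp
      | step _ hvl hlp _ ih =>
        obtain ⟨rfl, rfl⟩ := ih
        exact absurd (hz.eq hvl hrz.symm) hlp
    obtain h | h := (h.mono (Base' := fun p v => (p = r ∧ v = z) ∨ (p = r ∧ v = b))
      fun p v h => h.2.imp (⟨h.1, ·⟩) (⟨h.1, ·⟩)).or
    · exact .inl (hz' h).2
    · exact .inr ⟨p, h⟩
  have h3 : 1 < A.ncard := by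
    have haA : G.Fill (fun p v => p = r ∧ v = a) ch r a := .base ⟨rfl, rfl⟩
    rw [Set.one_lt_ncard]
    have hap : ¬ G.IsPendant a := fun h => hG r ⟨a, z, haz, h, hz, ha, hrz⟩
    obtain ⟨d, hd, hdr⟩ := exists_adj_ne_of_not_isPendant hap ha.symm
    by_cases hdp : G.IsPendant d
    · exact ⟨a, ⟨r, haA⟩, d, ⟨a, haA.leaf hd hdr hdp⟩, hd.ne⟩
    · exact ⟨a, ⟨r, haA⟩, ch a d, ⟨d, haA.step hd hdr hdp⟩, (hch hd hdp).2.symm⟩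
  have h4 := Set.ncard_union_eq hdisj
  have h5 := Set.ncard_le_ncard h1
  have h6 := Set.ncard_le_ncard h2
  have h7 := Set.ncard_insert_le z B
  omega

/-- Let `x₁ x₂ x₃` be a pendant path attached to a vertex `x₄` without pendant neighbours.  Then
every other neighbour `e` of `x₄` has a pendant neighbour.  Otherwise the minimal fort grown from
the edge `x₄ e` contains `x₄`, `x₂`, and every vertex except `x₃` of the fort grown from the
neighbours `x₃` and `e` of `x₄`, so that it is larger. -/
theorem IsTree.exists_isPendant_adj_of_pendant_path [Finite V] {G : SimpleGraph V}
    (hT : G.IsTree) (hG : ∀ w, ¬ G.HasDoublePendant w)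
    (hW : ∀ W, Minimal G.IsFort W → ∀ W', G.IsFort W' → W.ncard ≤ W'.ncard)
    {x₁ x₂ x₃ x₄ e : V} (h₁ : G.IsPendant x₁) (h₁₂ : G.Adj x₁ x₂) (h₂₃ : G.Adj x₂ x₃)
    (h₃₄ : G.Adj x₃ x₄) (h₁₃ : x₁ ≠ x₃) (h₂₄ : x₂ ≠ x₄)
    (h₂ : ∀ w, G.Adj x₂ w → w = x₁ ∨ w = x₃) (h₃ : ∀ w, G.Adj x₃ w → w = x₂ ∨ w = x₄)
    (h₄ : ∀ w, G.Adj x₄ w → ¬ G.IsPendant w) (he : G.Adj x₄ e) (hex : e ≠ x₃) :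
    ∃ z, G.Adj e z ∧ G.IsPendant z := by
  by_contra! hcon
  obtain ⟨ch, hch⟩ := G.exists_isChoice
  obtain ⟨hA, hxA⟩ := hT.minimal_isFort_filled hG hch h₃₄.symm he hex.symm
  have hC := hT.minimal_isFort_filled_edge hG hch he h₄ hcon
  have hle := hW _ hC _ hA.1
  have hp₂ : ¬ G.IsPendant x₂ := fun h => h₁₃ (h.eq h₁₂.symm h₂₃)
  have hp₃ : ¬ G.IsPendant x₃ := h₄ _ h₃₄.symm
  have hx₂A : x₂ ∉ G.filled (fun p v => p = x₄ ∧ (v = x₃ ∨ v = e)) ch := by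
    refine (Fill.base (G := G) (p := x₄) (v := x₃) ⟨rfl, .inl rfl⟩).not_mem_of_not_isPendant
      (hT.isOutward_isParent x₄) hch ?_ ?_ h₂₃.symm h₂₄ hp₂
    · rintro p v ⟨rfl, rfl | rfl⟩
      · exact isParent_root h₃₄.symm
      · exact isParent_root he
    · rintro p v d ⟨rfl, -⟩ h
      exact absurd h not_isParent_root
  set A := G.filled (fun p v => p = x₄ ∧ (v = x₃ ∨ v = e)) ch with hA'
  set BC : V → V → Prop := fun p v => p = x₄ ∧ v = e ∨ p = e ∧ v = x₄ with hBC
  have hc₃ : ch x₄ x₃ = x₂ := by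
    obtain ⟨h, h'⟩ := hch h₃₄.symm hp₃
    exact (h₃ _ h).resolve_right h'
  have hc₂ : ch x₃ x₂ = x₁ := by
    obtain ⟨h, h'⟩ := hch h₂₃.symm hp₂
    exact (h₂ _ h).resolve_right h'
  have hC₄ : G.Fill BC ch e x₄ := .base (.inr ⟨rfl, rfl⟩)
  have hC₂ : G.Fill BC ch x₃ x₂ := by
    have := hC₄.step h₃₄.symm hex.symm hp₃
    rwa [hc₃] at this
  have hC₁ : G.Fill BC ch x₂ x₁ := hC₂.leaf h₁₂.symm h₁₃ h₁
  have key : ∀ {p v}, G.Fill (fun p v => p = x₄ ∧ (v = x₃ ∨ v = e)) ch p v →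
      (p = x₄ ∧ v = x₃) ∨ (p = x₂ ∧ v = x₁) ∨ G.Fill BC ch p v := by
    intro p v h
    induction h with
    | base h =>
      obtain ⟨rfl, rfl | rfl⟩ := h
      · exact .inl ⟨rfl, rfl⟩
      · exact .inr (.inr (.base (.inl ⟨rfl, rfl⟩)))
    | leaf _ hvl hlp hl ih =>
      obtain ⟨rfl, rfl⟩ | ⟨rfl, rfl⟩ | ih := ih
      · exact absurd ((h₃ _ hvl).resolve_right hlp ▸ hl) hp₂
      · exact absurd (h₁.eq hvl h₁₂) hlp
      · exact .inr (.inr (.leaf ih hvl hlp hl))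
    | step _ hvl hlp hl ih =>
      obtain ⟨rfl, rfl⟩ | ⟨rfl, rfl⟩ | ih := ih
      · obtain rfl := (h₃ _ hvl).resolve_right hlp
        exact .inr (.inl ⟨rfl, hc₂⟩)
      · exact absurd (h₁.eq hvl h₁₂) hlp
      · exact .inr (.inr (.step ih hvl hlp hl))
  have hsub : A ⊆ insert x₃ (G.filled BC ch \ {x₄, x₂}) := by
    rintro v hv
    have hv' : v ∉ ({x₄, x₂} : Set V) := by
      rintro (rfl | rfl)
      exacts [hxA hv, hx₂A hv]
    obtain ⟨p, h⟩ := hv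
    obtain ⟨rfl, rfl⟩ | ⟨rfl, rfl⟩ | h := key h
    · exact .inl rfl
    · exact .inr ⟨⟨_, hC₁⟩, hv'⟩
    · exact .inr ⟨⟨_, h⟩, hv'⟩
  have h5 := Set.ncard_le_ncard hsub
  have h6 := Set.ncard_insert_le x₃ (G.filled BC ch \ {x₄, x₂})
  have h7 : ({x₄, x₂} : Set V) ⊆ G.filled BC ch := by
    rintro v (rfl | rfl)
    exacts [⟨_, hC₄⟩, ⟨_, hC₂⟩]
  have h8 := Set.ncard_sdiff_add_ncard_of_subset h7
  rw [Set.ncard_pair h₂₄.symm] at h8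
  omega

/-! ### Recognizing paths and `star222` -/

theorem Connected.mem_of_closed {G : SimpleGraph V} (hG : G.Connected) {S : Set V} {x : V}
    (hx : x ∈ S) (hS : ∀ v ∈ S, ∀ w, G.Adj v w → w ∈ S) (v : V) : v ∈ S := by
  obtain ⟨p⟩ := hG.preconnected x v
  induction p with
  | nil => exact hx
  | cons h p ih => exact ih (hS _ hx _ h)

/-- An injective homomorphism into a connected graph whose image contains all neighbours of its
vertices is an isomorphism. -/
theorem Connected.nonempty_iso {U : Type*} [Nonempty U] {G : SimpleGraph V} (hG : G.Connected)
    {H : SimpleGraph U} {f : U → V} (hf : Function.Injective f)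
    (hadj : ∀ i j, H.Adj i j → G.Adj (f i) (f j))
    (hnbr : ∀ i w, G.Adj (f i) w → ∃ j, H.Adj i j ∧ f j = w) : Nonempty (G ≃g H) := by
  have hsurj : Function.Surjective f := by
    obtain ⟨i⟩ := ‹Nonempty U›
    refine fun v => hG.mem_of_closed (S := Set.range f) ⟨i, rfl⟩ ?_ v
    rintro _ ⟨j, rfl⟩ w hw
    obtain ⟨k, -, hk⟩ := hnbr j w hw
    exact ⟨k, hk⟩
  refine ⟨RelIso.symm ⟨Equiv.ofBijective f ⟨hf, hsurj⟩, ?_⟩⟩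
  intro i j
  refine ⟨fun h => ?_, hadj i j⟩
  obtain ⟨k, hk, hkj⟩ := hnbr i _ h
  exact hf hkj ▸ hk

/-- Two distinct vertices of a tree have at most one common neighbour. -/
theorem IsTree.eq_of_adj_adj {G : SimpleGraph V} (hG : G.IsTree) {x y u w : V} (hxy : x ≠ y)
    (hux : G.Adj x u) (huy : G.Adj u y) (hwx : G.Adj x w) (hwy : G.Adj w y) : u = w :=
  ((isParent_root hux).child hG huy hxy.symm).eq hG ((isParent_root hwx).child hG hwy hxy.symm)

/-- A tree has no triangles. -/
theorem IsTree.not_adj_of_adj_adj {G : SimpleGraph V} (hG : G.IsTree) {x y u : V}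
    (hux : G.Adj x u) (huy : G.Adj u y) : ¬ G.Adj x y := fun h =>
  hux.ne (((isParent_root h).eq hG ((isParent_root hux).child hG huy h.ne')))

/-- A fort that contains `x₃` contains the end `x₁` of any leg `x₁ x₂` hanging off `x₃`. -/
theorem IsFort.mem_of_leg {G : SimpleGraph V} {F : Set V} (hF : G.IsFort F) {x₁ x₂ x₃ : V}
    (h₁ : G.IsPendant x₁) (h₁₂ : G.Adj x₁ x₂) (h₂₃ : G.Adj x₂ x₃)
    (h₂ : ∀ w, G.Adj x₂ w → w = x₁ ∨ w = x₃) (hx : x₃ ∈ F) : x₁ ∈ F := by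
  by_cases hx₂ : x₂ ∈ F
  · exact hF.mem_of_isPendant hx₂ h₁ h₁₂.symm
  · obtain ⟨w, hw, hw3, h⟩ := hF.2 hx₂ hx h₂₃
    exact (h₂ w h).resolve_right hw3 ▸ hw

theorem length_le_ncard_of_nodup [Finite V] {F : Set V} {L : List V} (hL : L.Nodup)
    (h : ∀ x ∈ L, x ∈ F) : L.length ≤ F.ncard := by
  classical
  rw [← List.toFinset_card_of_nodup hL, ← Set.ncard_coe_finset]
  exact Set.ncard_le_ncard fun x hx => h x (by simpa using hx)

theorem ncard_le_length {L : List V} : {x | x ∈ L}.ncard ≤ L.length := by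
  classical
  have h : {x | x ∈ L} = (L.toFinset : Set V) := by ext; simp
  rw [h, Set.ncard_coe_finset]
  exact L.toFinset_card_le

theorem IsTree.nonempty_iso_pathGraph_four [Finite V] {G : SimpleGraph V} (hT : G.IsTree)
    (hG : ∀ w, ¬ G.HasDoublePendant w)
    (hW : ∀ W, Minimal G.IsFort W → ∀ W', G.IsFort W' → W.ncard ≤ W'.ncard)
    {x₁ x₂ x₃ l : V} (h₁ : G.IsPendant x₁)
    (h₁₂ : G.Adj x₁ x₂) (h₂₃ : G.Adj x₂ x₃) (h₁₃ : x₁ ≠ x₃)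
    (h₂ : ∀ w, G.Adj x₂ w → w = x₁ ∨ w = x₃) (hl : G.IsPendant l) (h₃l : G.Adj x₃ l) :
    Nonempty (G ≃g pathGraph 4) := by
  have hp₂ : ¬ G.IsPendant x₂ := fun h => h₁₃ (h.eq h₁₂.symm h₂₃)
  have h₂l : x₂ ≠ l := fun h => hp₂ (h ▸ hl)
  have h₃ : ∀ w, G.Adj x₃ w → w = x₂ ∨ w = l := by
    intro w hw
    by_contra! hcon
    exact hcon.1 (hT.eq_of_adj_of_isPendant hG hW hl h₃l hw h₂₃.symm hcon.2 h₂l)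
  have h₁l : x₁ ≠ l := by
    rintro rfl
    exact h₂₃.ne (h₁.eq h₁₂ h₃l.symm)
  refine hT.1.nonempty_iso (f := ![x₁, x₂, x₃, l]) ?_ ?_ ?_
  · have := h₁₂.ne
    have := h₂₃.ne
    have := h₃l.ne
    intro i j
    fin_cases i <;> fin_cases j <;> simp <;> grind
  · intro i j
    rw [pathGraph_adj]
    have := h₁₂.symm
    have := h₂₃.symm
    have := h₃l.symm
    fin_cases i <;> fin_cases j <;> simp <;> assumption
  · intro i w hw
    simp_rw [pathGraph_adj]
    fin_cases i
    · exact ⟨1, by simp, h₁.eq h₁₂ hw⟩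
    · obtain rfl | rfl := h₂ w hw
      exacts [⟨0, by simp, rfl⟩, ⟨2, by simp, rfl⟩]
    · obtain rfl | rfl := h₃ w hw
      exacts [⟨1, by simp, rfl⟩, ⟨3, by simp, rfl⟩]
    · exact ⟨2, by simp, hl.eq h₃l.symm hw⟩

/-- Two legs hanging off the same vertex form a fort. -/
theorem isFort_pair_of_legs {G : SimpleGraph V} {x₁ x₂ x₃ y₁ y₂ : V}
    (h₁ : G.IsPendant x₁) (h₁₂ : G.Adj x₁ x₂) (h₂₃ : G.Adj x₂ x₃)
    (h₂ : ∀ w, G.Adj x₂ w → w = x₁ ∨ w = x₃)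
    (k₁ : G.IsPendant y₁) (k₁₂ : G.Adj y₁ y₂) (k₂₃ : G.Adj y₂ x₃)
    (k₂ : ∀ w, G.Adj y₂ w → w = y₁ ∨ w = x₃) (hne : x₂ ≠ y₂) :
    G.IsFort {x | x ∈ [x₁, x₂, y₁, y₂]} := by
  refine ⟨⟨x₁, by simp⟩, fun u v hu hv huv => ?_⟩
  have key : ∀ a, a ∈ ({x₂, y₂} : Set V) →
      ∃ w ∈ {x | x ∈ [x₁, x₂, y₁, y₂]}, w ≠ a ∧ G.Adj x₃ w := by
    rintro a (rfl | rfl)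
    · exact ⟨y₂, by simp, hne.symm, k₂₃.symm⟩
    · exact ⟨x₂, by simp, hne, h₂₃.symm⟩
  simp only [Set.mem_ofPred_eq, List.mem_cons, List.not_mem_nil, or_false, not_or] at hu hv
  obtain rfl | rfl | rfl | rfl := hv
  · exact absurd (h₁.eq huv.symm h₁₂) hu.2.1
  · obtain rfl := (h₂ u huv.symm).resolve_left hu.1
    exact key _ (by simp)
  · exact absurd (k₁.eq huv.symm k₁₂) hu.2.2.2
  · obtain rfl := (k₂ u huv.symm).resolve_left hu.2.2.1
    exact key _ (by simp)

/-- If two legs hang off `x₃`, then every minimal fort has at most four elements; a minimal fort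
that contains `x₃` contains the ends of both legs, so it has only one element `z` left to account
for a further neighbour `d`.  This forces `d` to be the support of a third leg. -/
theorem IsTree.leg_of_two_legs [Finite V] {G : SimpleGraph V} (hT : G.IsTree)
    (hG : ∀ w, ¬ G.HasDoublePendant w)
    (hW : ∀ W, Minimal G.IsFort W → ∀ W', G.IsFort W' → W.ncard ≤ W'.ncard)
    {x₁ x₂ x₃ y₁ y₂ d : V}
    (h₁ : G.IsPendant x₁) (h₁₂ : G.Adj x₁ x₂) (h₂₃ : G.Adj x₂ x₃) (h₁₃ : x₁ ≠ x₃)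
    (h₂ : ∀ w, G.Adj x₂ w → w = x₁ ∨ w = x₃)
    (k₁ : G.IsPendant y₁) (k₁₂ : G.Adj y₁ y₂) (k₂₃ : G.Adj y₂ x₃) (k₁₃ : y₁ ≠ x₃)
    (k₂ : ∀ w, G.Adj y₂ w → w = y₁ ∨ w = x₃) (hne : x₂ ≠ y₂)
    (hd : G.Adj x₃ d) (hd₂ : d ≠ x₂) (hdy : d ≠ y₂) (hdp : ¬ G.IsPendant d) :
    ∃ z, G.IsPendant z ∧ G.Adj z d ∧ z ≠ x₃ ∧ ∀ w, G.Adj d w → w = z ∨ w = x₃ := by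
  have hp₂ : ¬ G.IsPendant x₂ := fun h => h₁₃ (h.eq h₁₂.symm h₂₃)
  have hp₃ : ¬ G.IsPendant x₃ := fun h => hne (h.eq h₂₃.symm k₂₃.symm)
  obtain ⟨F, hF, hx₃⟩ := hT.exists_minimal_isFort_mem hG h₂₃.symm hp₂
  have hx₁ := hF.1.mem_of_leg h₁ h₁₂ h₂₃ h₂ hx₃
  have hy₁ := hF.1.mem_of_leg k₁ k₁₂ k₂₃ k₂ hx₃
  have hxy : x₁ ≠ y₁ := by
    rintro rfl
    exact hne (h₁.eq h₁₂ k₁₂)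
  have hcard : F.ncard ≤ 4 :=
    (hW F hF _ (isFort_pair_of_legs h₁ h₁₂ h₂₃ h₂ k₁ k₁₂ k₂₃ k₂ hne)).trans ncard_le_length
  have hall : ∀ y ∈ F, y ≠ x₃ → y ≠ x₁ → y ≠ y₁ →
      ∀ w ∈ F, w = x₃ ∨ w = x₁ ∨ w = y₁ ∨ w = y := by
    intro y hy hy₃ hyx hyy w hw
    by_contra! hcon
    have := length_le_ncard_of_nodup (F := F) (L := [x₃, x₁, y₁, y, w])
      (by simp; grind) (by simp; grind)
    simp at this
    omega
  have hxd : ¬ G.Adj d x₁ := fun h => hd₂ (h₁.eq h.symm h₁₂)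
  have hyd : ¬ G.Adj d y₁ := fun h => hdy (k₁.eq h.symm k₁₂)
  have hdx₁ : d ≠ x₁ := fun h => hdp (h ▸ h₁)
  have hdy₁ : d ≠ y₁ := fun h => hdp (h ▸ k₁)
  have h₂' : ∀ w, G.Adj x₁ w → ∀ v, G.Adj w v → v = x₁ ∨ v = x₃ := by
    intro w hw
    obtain rfl := h₁.eq h₁₂ hw
    exact h₂
  have k₂' : ∀ w, G.Adj y₁ w → ∀ v, G.Adj w v → v = y₁ ∨ v = x₃ := by
    intro w hw
    obtain rfl := k₁.eq k₁₂ hw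
    exact k₂
  have hdF : d ∉ F := by
    intro hdF
    obtain ⟨c, hdc, hc₃⟩ := exists_adj_ne_of_not_isPendant hdp hd.symm
    have hF4 := hall d hdF hd.ne' hdx₁ hdy₁
    have hcF : c ∉ F := by
      intro hcF
      obtain rfl | rfl | rfl | rfl := hF4 c hcF
      exacts [hc₃ rfl, hxd hdc, hyd hdc, hdc.ne rfl]
    obtain ⟨w, hwF, hwd, hcw⟩ := hF.1.2 hcF hdF hdc.symm
    obtain rfl | rfl | rfl | rfl := hF4 w hwF
    · exact hT.not_adj_of_adj_adj hd hdc hcw.symm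
    · exact (h₂' c hcw.symm d hdc.symm).elim hdx₁ hd.ne'
    · exact (k₂' c hcw.symm d hdc.symm).elim hdy₁ hd.ne'
    · exact hwd rfl
  obtain ⟨z, hzF, hz₃, hdz⟩ := hF.1.2 hdF hx₃ hd.symm
  have hzx : z ≠ x₁ := fun h => hxd (h ▸ hdz)
  have hzy : z ≠ y₁ := fun h => hyd (h ▸ hdz)
  have hF4 := hall z hzF hz₃ hzx hzy
  have hz : G.IsPendant z := by
    refine isPendant_of_forall_eq hdz.symm fun s hs => ?_
    by_contra hsd
    have hsF : s ∉ F := by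
      intro hsF
      obtain rfl | rfl | rfl | rfl := hF4 s hsF
      · exact hT.not_adj_of_adj_adj hd hdz hs.symm
      · exact (h₂' z hs.symm d hdz.symm).elim hdx₁ hd.ne'
      · exact (k₂' z hs.symm d hdz.symm).elim hdy₁ hd.ne'
      · exact hs.ne rfl
    obtain ⟨w, hwF, hwz, hsw⟩ := hF.1.2 hsF hzF hs.symm
    obtain rfl | rfl | rfl | rfl := hF4 w hwF
    · exact hsd (hT.eq_of_adj_adj hz₃.symm hsw.symm hs.symm hd hdz)
    · exact (h₂' s hsw.symm z hs.symm).elim hzx hz₃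
    · exact (k₂' s hsw.symm z hs.symm).elim hzy hz₃
    · exact hwz rfl
  refine ⟨z, hz, hdz.symm, hz₃, fun w hw => ?_⟩
  by_contra! hcon
  exact hcon.2 (hT.eq_of_adj_of_isPendant hG hW hz hdz hw hd.symm hcon.1 hz₃.symm)

theorem isFort_alternating_of_legs {G : SimpleGraph V} {x₁ x₂ x₃ y₁ y₂ : V}
    (h₁ : G.IsPendant x₁) (h₁₂ : G.Adj x₁ x₂) (h₂₃ : G.Adj x₂ x₃) (h₁₃ : x₁ ≠ x₃)
    (k₁ : G.IsPendant y₁) (k₁₂ : G.Adj y₁ y₂) (k₂₃ : G.Adj y₂ x₃) (k₁₃ : y₁ ≠ x₃)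
    (h₃ : ∀ w, G.Adj x₃ w → w = x₂ ∨ w = y₂) :
    G.IsFort {x | x ∈ [x₁, x₃, y₁]} := by
  have key : ∀ u v, u = x₂ ∨ u = y₂ → ∃ w ∈ {x | x ∈ [x₁, x₃, y₁]}, w ≠ v ∧ G.Adj u w := by
    rintro u v (rfl | rfl)
    · by_cases hv : v = x₃
      · exact ⟨x₁, by simp, hv ▸ h₁₃, h₁₂.symm⟩
      · exact ⟨x₃, by simp, Ne.symm hv, h₂₃⟩
    · by_cases hv : v = x₃
      · exact ⟨y₁, by simp, hv ▸ k₁₃, k₁₂.symm⟩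
      · exact ⟨x₃, by simp, Ne.symm hv, k₂₃⟩
  refine ⟨⟨x₁, by simp⟩, fun u v hu hv huv => key u v ?_⟩
  simp only [Set.mem_ofPred_eq, List.mem_cons, List.not_mem_nil, or_false] at hv
  obtain rfl | rfl | rfl := hv
  · exact .inl (h₁.eq huv.symm h₁₂)
  · exact h₃ u huv.symm
  · exact .inr (k₁.eq huv.symm k₁₂)

theorem star222_adj_iff {i j : Fin 7} : star222.Adj i j ↔
    (i, j) ∈ [((0 : Fin 7), (1 : Fin 7)), (1, 0), (1, 2), (2, 1), (0, 3), (3, 0), (3, 4), (4, 3),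
      (0, 5), (5, 0), (5, 6), (6, 5)] := by
  simp only [star222, fromEdgeSet_adj, Set.mem_insert_iff, Set.mem_singleton_iff]
  revert i j
  decide

/-- Two legs hang off `x₃`.  A third one exists, since otherwise the tree is a path with five
vertices, which has minimal forts of three and of four elements.  A fourth one does not, since a
minimal fort that contains `x₃` contains the ends of all legs. -/
theorem IsTree.nonempty_iso_star222 [Finite V] {G : SimpleGraph V} (hT : G.IsTree)
    (hG : ∀ w, ¬ G.HasDoublePendant w)
    (hW : ∀ W, Minimal G.IsFort W → ∀ W', G.IsFort W' → W.ncard ≤ W'.ncard)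
    {x₁ x₂ x₃ y₁ y₂ : V}
    (h₁ : G.IsPendant x₁) (h₁₂ : G.Adj x₁ x₂) (h₂₃ : G.Adj x₂ x₃) (h₁₃ : x₁ ≠ x₃)
    (h₂ : ∀ w, G.Adj x₂ w → w = x₁ ∨ w = x₃)
    (k₁ : G.IsPendant y₁) (k₁₂ : G.Adj y₁ y₂) (k₂₃ : G.Adj y₂ x₃) (k₁₃ : y₁ ≠ x₃)
    (k₂ : ∀ w, G.Adj y₂ w → w = y₁ ∨ w = x₃) (hne : x₂ ≠ y₂)
    (h₃ : ∀ w, G.Adj x₃ w → ¬ G.IsPendant w) :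
    Nonempty (G ≃g star222) := by
  have hxy : x₁ ≠ y₁ := by
    rintro rfl
    exact hne (h₁.eq h₁₂ k₁₂)
  have hp₂ := h₃ x₂ h₂₃.symm
  have kp₂ := h₃ y₂ k₂₃.symm
  have hp₃ : ¬ G.IsPendant x₃ := fun h => hne (h.eq h₂₃.symm k₂₃.symm)
  have hleg : ∀ {d}, G.Adj x₃ d → d ≠ x₂ → d ≠ y₂ →
      ∃ z, G.IsPendant z ∧ G.Adj z d ∧ z ≠ x₃ ∧ ∀ w, G.Adj d w → w = z ∨ w = x₃ :=
    fun hd hd₂ hdy => hT.leg_of_two_legs hG hW h₁ h₁₂ h₂₃ h₁₃ h₂ k₁ k₁₂ k₂₃ k₁₃ k₂ hne hd hd₂ hdy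
      (h₃ _ hd)
  have hd : ∃ d, G.Adj x₃ d ∧ d ≠ x₂ ∧ d ≠ y₂ := by
    by_contra! hcon
    obtain ⟨F, hF, hx₂, hy₂, -⟩ :=
      hT.exists_minimal_isFort_of_adj_of_adj hG h₂₃.symm k₂₃.symm hne
    have hle := (hW F hF _ (isFort_alternating_of_legs h₁ h₁₂ h₂₃ h₁₃ k₁ k₁₂ k₂₃ k₁₃
      fun w hw => or_iff_not_imp_left.mpr (hcon w hw))).trans ncard_le_length
    have hx₁ := hF.1.mem_of_isPendant hx₂ h₁ h₁₂.symm
    have hy₁ := hF.1.mem_of_isPendant hy₂ k₁ k₁₂.symm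
    have := length_le_ncard_of_nodup (F := F) (L := [x₂, y₂, x₁, y₁])
      (by simp; grind) (by simp; grind)
    simp at this hle
    omega
  obtain ⟨d, hd, hd₂, hdy⟩ := hd
  obtain ⟨z, hz, hzd, hz₃, hdz⟩ := hleg hd hd₂ hdy
  have hdp := h₃ d hd
  have hN : ∀ w, G.Adj x₃ w → w = x₂ ∨ w = y₂ ∨ w = d := by
    intro d' hd'
    by_contra! hcon
    obtain ⟨z', hz', hzd', hz₃', hdz'⟩ := hleg hd' hcon.1 hcon.2.1
    obtain ⟨F, hF, hx₃⟩ := hT.exists_minimal_isFort_mem hG h₂₃.symm hp₂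
    have hle := (hW F hF _ (isFort_pair_of_legs h₁ h₁₂ h₂₃ h₂ k₁ k₁₂ k₂₃ k₂ hne)).trans
      ncard_le_length
    have hx₁ := hF.1.mem_of_leg h₁ h₁₂ h₂₃ h₂ hx₃
    have hy₁ := hF.1.mem_of_leg k₁ k₁₂ k₂₃ k₂ hx₃
    have hzF := hF.1.mem_of_leg hz hzd hd.symm hdz hx₃
    have hzF' := hF.1.mem_of_leg hz' hzd' hd'.symm hdz' hx₃
    have e1 : z ≠ x₁ := by rintro rfl; exact hd₂ (h₁.eq hzd h₁₂)
    have e2 : z ≠ y₁ := by rintro rfl; exact hdy (k₁.eq hzd k₁₂)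
    have e3 : z' ≠ x₁ := by rintro rfl; exact hcon.1 (h₁.eq hzd' h₁₂)
    have e4 : z' ≠ y₁ := by rintro rfl; exact hcon.2.1 (k₁.eq hzd' k₁₂)
    have e5 : z' ≠ z := by rintro rfl; exact hcon.2.2 (hz.eq hzd' hzd)
    have := length_le_ncard_of_nodup (F := F) (L := [x₃, x₁, y₁, z, z'])
      (by simp; grind) (by simp; grind)
    simp at this hle
    omega
  have e1 : z ≠ x₁ := by rintro rfl; exact hd₂ (h₁.eq hzd h₁₂)
  have e2 : z ≠ y₁ := by rintro rfl; exact hdy (k₁.eq hzd k₁₂)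
  have e3 := h₂₃.ne
  have e4 := k₂₃.ne
  have e5 := hd.ne
  have a1 := h₁₂.symm
  have a2 := h₂₃.symm
  have a3 := k₁₂.symm
  have a4 := k₂₃.symm
  have a5 := hd.symm
  have a6 := hzd.symm
  refine hT.1.nonempty_iso (f := ![x₃, x₂, x₁, y₂, y₁, d, z]) ?_ ?_ ?_
  · rw [← List.nodup_ofFn]
    simp
    grind
  · intro i j
    rw [star222_adj_iff]
    fin_cases i <;> fin_cases j <;> simp <;> assumption
  · intro i w hw
    simp_rw [star222_adj_iff]
    fin_cases i
    · obtain rfl | rfl | rfl := hN w hw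
      exacts [⟨1, by simp, rfl⟩, ⟨3, by simp, rfl⟩, ⟨5, by simp, rfl⟩]
    · obtain rfl | rfl := h₂ w hw
      exacts [⟨2, by simp, rfl⟩, ⟨0, by simp, rfl⟩]
    · exact ⟨1, by simp, h₁.eq h₁₂ hw⟩
    · obtain rfl | rfl := k₂ w hw
      exacts [⟨4, by simp, rfl⟩, ⟨0, by simp, rfl⟩]
    · exact ⟨3, by simp, k₁.eq k₁₂ hw⟩
    · obtain rfl | rfl := hdz w hw
      exacts [⟨6, by simp, rfl⟩, ⟨0, by simp, rfl⟩]
    · exact ⟨5, by simp, hz.eq hzd hw⟩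

/-- A pendant path `x₁ x₂ x₃` is attached to `x₄`.  A minimal fort that contains `x₄` also contains
`x₁` and one of `x₂`, `x₃`.  It is compared with small forts to see that `x₄` has no pendant
neighbour and at most one leg. -/
theorem IsTree.nonempty_iso_pathGraph_six [Finite V] {G : SimpleGraph V} (hT : G.IsTree)
    (hG : ∀ w, ¬ G.HasDoublePendant w)
    (hW : ∀ W, Minimal G.IsFort W → ∀ W', G.IsFort W' → W.ncard ≤ W'.ncard)
    {x₁ x₂ x₃ x₄ : V}
    (h₁ : G.IsPendant x₁) (h₁₂ : G.Adj x₁ x₂) (h₂₃ : G.Adj x₂ x₃) (h₃₄ : G.Adj x₃ x₄)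
    (h₁₃ : x₁ ≠ x₃) (h₂₄ : x₂ ≠ x₄)
    (h₂ : ∀ w, G.Adj x₂ w → w = x₁ ∨ w = x₃) (h₃ : ∀ w, G.Adj x₃ w → w = x₂ ∨ w = x₄)
    (hp₄ : ¬ G.IsPendant x₄) :
    Nonempty (G ≃g pathGraph 6) := by
  have hp₂ : ¬ G.IsPendant x₂ := fun h => h₁₃ (h.eq h₁₂.symm h₂₃)
  have hp₃ : ¬ G.IsPendant x₃ := fun h => h₂₄ (h.eq h₂₃.symm h₃₄)
  obtain ⟨F, hF, hx₄⟩ := hT.exists_minimal_isFort_mem hG h₃₄.symm hp₃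
  have hx : x₁ ∈ F ∧ (x₂ ∈ F ∨ x₃ ∈ F) := by
    by_cases hx₃ : x₃ ∈ F
    · exact ⟨hF.1.mem_of_leg h₁ h₁₂ h₂₃ h₂ hx₃, .inr hx₃⟩
    · obtain ⟨w, hw, hw4, h⟩ := hF.1.2 hx₃ hx₄ h₃₄
      obtain rfl := (h₃ w h).resolve_right hw4
      exact ⟨hF.1.mem_of_isPendant hw h₁ h₁₂.symm, .inl hw⟩
  obtain ⟨hx₁, y, hyF, hy⟩ : x₁ ∈ F ∧ ∃ y ∈ F, y = x₂ ∨ y = x₃ :=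
    ⟨hx.1, hx.2.elim (fun h => ⟨_, h, .inl rfl⟩) fun h => ⟨_, h, .inr rfl⟩⟩
  have hyp : ¬ G.IsPendant y := by rcases hy with rfl | rfl <;> assumption
  have hy₄ : y ≠ x₄ := by
    rcases hy with rfl | rfl
    exacts [h₂₄, h₃₄.ne]
  have h₄ : ∀ w, G.Adj x₄ w → ¬ G.IsPendant w := by
    intro l hl hlp
    have hl₁ : l ≠ x₁ := by
      rintro rfl
      exact h₂₄ (h₁.eq h₁₂ hl.symm)
    have h₄ : ∀ w, G.Adj x₄ w → w = x₃ ∨ w = l := by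
      intro w hw
      by_contra! hcon
      exact hcon.1 (hT.eq_of_adj_of_isPendant hG hW hlp hl hw h₃₄.symm hcon.2
        fun h => hp₃ (h ▸ hlp))
    have hfort : G.IsFort {x | x ∈ [x₁, x₃, l]} := by
      have key : ∀ u v, u = x₂ ∨ u = x₄ → ∃ w ∈ {x | x ∈ [x₁, x₃, l]}, w ≠ v ∧ G.Adj u w := by
        rintro u v (rfl | rfl)
        · by_cases hv : v = x₃
          · exact ⟨x₁, by simp, hv ▸ h₁₃, h₁₂.symm⟩
          · exact ⟨x₃, by simp, Ne.symm hv, h₂₃⟩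
        · by_cases hv : v = x₃
          · exact ⟨l, by simp, fun h => hp₃ (hv ▸ h ▸ hlp), hl⟩
          · exact ⟨x₃, by simp, Ne.symm hv, h₃₄.symm⟩
      refine ⟨⟨x₁, by simp⟩, fun u v hu hv huv => key u v ?_⟩
      simp only [Set.mem_ofPred_eq, List.mem_cons, List.not_mem_nil, or_false] at hv
      obtain rfl | rfl | rfl := hv
      · exact .inl (h₁.eq huv.symm h₁₂)
      · exact h₃ u huv.symm
      · exact .inr (hlp.eq huv.symm hl.symm)
    have hle := (hW F hF _ hfort).trans ncard_le_length
    have hlF := hF.1.mem_of_isPendant hx₄ hlp hl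
    have := length_le_ncard_of_nodup (F := F) (L := [x₄, x₁, y, l])
      (by simp; grind) (by simp; grind)
    simp at this hle
    omega
  have hleg : ∀ e, G.Adj x₄ e → e ≠ x₃ → ∃ z, G.IsPendant z ∧ G.Adj z e ∧ z ≠ x₄ ∧
      ∀ w, G.Adj e w → w = z ∨ w = x₄ := by
    intro e he he₃
    obtain ⟨z, hez, hz⟩ := hT.exists_isPendant_adj_of_pendant_path hG hW h₁ h₁₂ h₂₃ h₃₄ h₁₃ h₂₄
      h₂ h₃ h₄ he he₃
    have hz₄ : z ≠ x₄ := fun h => hp₄ (h ▸ hz)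
    refine ⟨z, hz, hez.symm, hz₄, fun w hw => ?_⟩
    by_contra! hcon
    exact hcon.2 (hT.eq_of_adj_of_isPendant hG hW hz hez hw he.symm hcon.1 hz₄.symm)
  obtain ⟨e, he, he₃⟩ := exists_adj_ne_of_not_isPendant hp₄ h₃₄.symm
  obtain ⟨z, hz, hze, hz₄, hez⟩ := hleg e he he₃
  have hpe := h₄ e he
  have hz₁ : ∀ {e z}, G.Adj x₄ e → e ≠ x₃ → G.Adj z e → z ≠ x₁ := by
    rintro e z he he₃ hze rfl
    obtain rfl := h₁.eq h₁₂ hze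
    exact (h₂ _ he.symm).elim (fun h => hp₄ (h ▸ h₁)) h₃₄.ne'
  have hN : ∀ w, G.Adj x₄ w → w = x₃ ∨ w = e := by
    intro e' he'
    by_contra! hcon
    obtain ⟨z', hz', hze', hz₄', hez'⟩ := hleg e' he' hcon.1
    have hle := (hW F hF _ (isFort_pair_of_legs hz hze he.symm hez hz' hze' he'.symm hez'
      hcon.2.symm)).trans ncard_le_length
    have hzF := hF.1.mem_of_leg hz hze he.symm hez hx₄
    have hzF' := hF.1.mem_of_leg hz' hze' he'.symm hez' hx₄
    have e1 := hz₁ he he₃ hze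
    have e2 := hz₁ he' hcon.1 hze'
    have e3 : z ≠ z' := by rintro rfl; exact hcon.2 (hz.eq hze' hze)
    have := length_le_ncard_of_nodup (F := F) (L := [x₄, x₁, y, z, z'])
      (by simp; grind) (by simp; grind)
    simp at this hle
    omega
  have e1 := hz₁ he he₃ hze
  have e2 : e ≠ x₂ := by
    rintro rfl
    exact (h₂ _ he.symm).elim (fun h => hp₄ (h ▸ h₁)) h₃₄.ne'
  have e3 := h₂₃.ne
  have e4 := h₃₄.ne
  have e5 := he.ne
  have a1 := h₁₂.symm
  have a2 := h₂₃.symm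
  have a3 := h₃₄.symm
  have a4 := he.symm
  have a5 := hze.symm
  refine hT.1.nonempty_iso (f := ![x₁, x₂, x₃, x₄, e, z]) ?_ ?_ ?_
  · rw [← List.nodup_ofFn]
    simp
    grind
  · intro i j
    rw [pathGraph_adj]
    fin_cases i <;> fin_cases j <;> simp <;> assumption
  · intro i w hw
    simp_rw [pathGraph_adj]
    fin_cases i
    · exact ⟨1, by simp, h₁.eq h₁₂ hw⟩
    · obtain rfl | rfl := h₂ w hw
      exacts [⟨0, by simp, rfl⟩, ⟨2, by simp, rfl⟩]
    · obtain rfl | rfl := h₃ w hw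
      exacts [⟨1, by simp, rfl⟩, ⟨3, by simp, rfl⟩]
    · obtain rfl | rfl := hN w hw
      exacts [⟨2, by simp, rfl⟩, ⟨4, by simp, rfl⟩]
    · obtain rfl | rfl := hez w hw
      exacts [⟨5, by simp, rfl⟩, ⟨3, by simp, rfl⟩]
    · exact ⟨4, by simp, hz.eq hze hw⟩

/-! ### The exceptional trees are well-failed -/

theorem isWellFailed_of_forall_exists_isFort [Finite V] {G : SimpleGraph V} {k : ℕ}
    (h : ∀ W, G.IsFort W → ∃ W' ⊆ W, G.IsFort W' ∧ W'.ncard = k) : G.IsWellFailed := by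
  rw [isWellFailed_iff]
  intro W hW W' hW'
  obtain ⟨A, hAW, hA, hAk⟩ := h W hW.1
  obtain ⟨B, hBW, -, hBk⟩ := h W' hW'
  rw [hW.eq_of_superset hA hAW, hAk, ← hBk]
  exact Set.ncard_le_ncard hBW

theorem IsFort.image {U : Type*} {G : SimpleGraph V} {H : SimpleGraph U} (e : G ≃g H) {W : Set V}
    (hW : G.IsFort W) : H.IsFort (e '' W) := by
  refine ⟨hW.1.image e, ?_⟩
  rintro u _ hu ⟨v, hv, rfl⟩ huv
  obtain ⟨u, rfl⟩ := e.surjective u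
  obtain ⟨w, hw, hwv, huw⟩ := hW.2 (fun h => hu ⟨u, h, rfl⟩) hv (e.map_adj_iff.mp huv)
  exact ⟨e w, ⟨w, hw, rfl⟩, e.injective.ne hwv, e.map_adj_iff.mpr huw⟩

/-- Well-failedness of `G` from a family of forts of equal size in an isomorphic graph, such that
every fort contains one of the family. -/
theorem Iso.isWellFailed [Finite V] {U : Type*} {G : SimpleGraph V} {H : SimpleGraph U}
    (e : G ≃g H) {k : ℕ}
    (h : ∀ W, H.IsFort W → ∃ W' ⊆ W, H.IsFort W' ∧ W'.ncard = k) : G.IsWellFailed := by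
  refine isWellFailed_of_forall_exists_isFort (k := k) fun W hW => ?_
  obtain ⟨A, hAW, hA, hAk⟩ := h _ (hW.image e)
  refine ⟨e.symm '' A, ?_, hA.image e.symm, ?_⟩
  · rintro _ ⟨a, ha, rfl⟩
    obtain ⟨w, hw, rfl⟩ := hAW ha
    simpa using hw
  · rw [Set.ncard_image_of_injective _ e.symm.injective, hAk]

theorem isFort_coe_iff {n : ℕ} {H : SimpleGraph (Fin n)} {r : Fin n → Fin n → Bool}
    (hr : ∀ i j, H.Adj i j ↔ r i j = true) {W : Finset (Fin n)} :
    H.IsFort (W : Set (Fin n)) ↔ W.Nonempty ∧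
      ∀ v ∈ W, ∀ u, r u v = true → u ∈ W ∨ ∃ w ∈ W, w ≠ v ∧ r u w = true := by
  simp only [IsFort, hr, Finset.mem_coe, Finset.coe_nonempty]
  refine and_congr_right fun _ => ⟨fun h v hv u huv => ?_, fun h u v hu hv huv => ?_⟩
  · exact or_iff_not_imp_left.mpr fun hu => h hu hv huv
  · exact (h v hv u huv).resolve_left hu

/-- Reduction to a decidable statement: adjacency is given by the Boolean function `r`, and `L` is
a list of forts with `k` elements such that every fort contains one of them. -/
theorem forall_isFort_of_finset {n k : ℕ} {H : SimpleGraph (Fin n)} {r : Fin n → Fin n → Bool}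
    (hr : ∀ i j, H.Adj i j ↔ r i j = true) (L : List (Finset (Fin n)))
    (hL : ∀ A ∈ L, A.card = k ∧ A.Nonempty ∧
      ∀ v ∈ A, ∀ u, r u v = true → u ∈ A ∨ ∃ w ∈ A, w ≠ v ∧ r u w = true)
    (h : ∀ W : Finset (Fin n), W.Nonempty →
      (∀ v ∈ W, ∀ u, r u v = true → u ∈ W ∨ ∃ w ∈ W, w ≠ v ∧ r u w = true) → ∃ A ∈ L, A ⊆ W) :
    ∀ W, H.IsFort W → ∃ W' ⊆ W, H.IsFort W' ∧ W'.ncard = k := by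
  classical
  intro W hW
  obtain ⟨W, rfl⟩ := (Set.toFinite W).exists_finset_coe
  rw [isFort_coe_iff hr] at hW
  obtain ⟨A, hA, hAW⟩ := h W hW.1 hW.2
  refine ⟨A, by exact_mod_cast hAW, (isFort_coe_iff hr).mpr (hL A hA).2, ?_⟩
  rw [Set.ncard_coe_finset, (hL A hA).1]

/-- Adjacency in the path with vertices `0, …, n - 1`, as a Boolean function. -/
def pathBool (n : ℕ) (i j : Fin n) : Bool := i.val + 1 == j.val || j.val + 1 == i.val

theorem pathGraph_adj_iff {n : ℕ} (i j : Fin n) :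
    (pathGraph n).Adj i j ↔ pathBool n i j = true := by
  simp [pathGraph_adj, pathBool]

theorem isWellFailed_of_iso_pathGraph [Finite V] [Nonempty V] {G : SimpleGraph V} {n : ℕ}
    (hn : n ≤ 4 ∨ n = 6) (e : G ≃g pathGraph n) : G.IsWellFailed := by
  have hcases : n = 0 ∨ n = 1 ∨ n = 2 ∨ n = 3 ∨ n = 4 ∨ n = 6 := by omega
  obtain rfl | rfl | rfl | rfl | rfl | rfl := hcases
  · -- `pathGraph 0` has no vertices, unlike `V`.
    exact (e (Classical.arbitrary V)).elim0
  · exact e.isWellFailed (k := 1) (forall_isFort_of_finset pathGraph_adj_iff [{0}]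
      (by decide) (by decide))
  · exact e.isWellFailed (k := 2) (forall_isFort_of_finset pathGraph_adj_iff [{0, 1}]
      (by decide) (by decide))
  · exact e.isWellFailed (k := 2) (forall_isFort_of_finset pathGraph_adj_iff [{0, 2}]
      (by decide) (by decide))
  · exact e.isWellFailed (k := 3) (forall_isFort_of_finset pathGraph_adj_iff [{0, 1, 3}, {0, 2, 3}]
      (by decide) (by decide))
  · exact e.isWellFailed (k := 4) (forall_isFort_of_finset pathGraph_adj_iff
      [{0, 2, 4, 5}, {0, 1, 3, 5}, {0, 2, 3, 5}]
      (by decide) (by decide +kernel))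

theorem isWellFailed_of_iso_star222 [Finite V] {G : SimpleGraph V}
    (e : G ≃g star222) : G.IsWellFailed :=
  e.isWellFailed (k := 4) (forall_isFort_of_finset
    (r := fun i j => (i, j) ∈ [((0 : Fin 7), (1 : Fin 7)), (1, 0), (1, 2), (2, 1), (0, 3), (3, 0),
      (3, 4), (4, 3), (0, 5), (5, 0), (5, 6), (6, 5)])
    (fun i j => star222_adj_iff.trans (decide_eq_true_iff).symm)
    [{1, 2, 3, 4}, {1, 2, 5, 6}, {3, 4, 5, 6}, {0, 2, 4, 6}]
    (by decide +kernel) (by decide +kernel))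

/-! ### Leafy graphs -/

theorem HasDoublePendant.not_isPendant {G : SimpleGraph V} {w : V} (h : G.HasDoublePendant w) :
    ¬ G.IsPendant w := by
  obtain ⟨v, v', hne, -, -, hv, hv'⟩ := h
  exact fun hw => hne (hw.eq hv hv')

theorem isFort_pair_of_twins {G : SimpleGraph V} {w v v' : V} (hv : G.IsPendant v)
    (hv' : G.IsPendant v') (hne : v ≠ v') (hwv : G.Adj w v) (hwv' : G.Adj w v') :
    G.IsFort {v, v'} := by
  refine ⟨⟨v, by simp⟩, ?_⟩
  rintro u _ - (rfl | rfl) huv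
  · obtain rfl := hv.eq huv.symm hwv.symm
    exact ⟨v', by simp, hne.symm, hwv'⟩
  · obtain rfl := hv'.eq huv.symm hwv'.symm
    exact ⟨v, by simp, hne, hwv⟩

theorem IsLeafy.isWellFailed [Finite V] {G : SimpleGraph V} (hG : G.IsLeafy) :
    G.IsWellFailed := by
  refine isWellFailed_of_forall_exists_isFort (k := 2) fun W hW => ?_
  have key : ∀ x ∈ W, ¬ G.IsPendant x → ∃ W' ⊆ W, G.IsFort W' ∧ W'.ncard = 2 := by
    intro x hx hxp
    obtain ⟨v, v', hne, hv, hv', hxv, hxv'⟩ := hG x hxp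
    refine ⟨{v, v'}, Set.pair_subset (hW.mem_of_isPendant hx hv hxv)
      (hW.mem_of_isPendant hx hv' hxv'), isFort_pair_of_twins hv hv' hne hxv hxv',
      Set.ncard_pair hne⟩
  obtain ⟨x, hx⟩ := hW.1
  by_cases hxp : G.IsPendant x
  · obtain ⟨u, hu⟩ := Set.ncard_eq_one.mp hxp
    have hxu : G.Adj x u := by
      have : u ∈ G.neighborSet x := hu ▸ Set.mem_singleton u
      exact this
    by_cases huW : u ∈ W
    · by_cases hup : G.IsPendant u
      · refine ⟨{x, u}, Set.pair_subset hx huW, ⟨⟨x, by simp⟩, ?_⟩, Set.ncard_pair hxu.ne⟩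
        rintro w _ hw (rfl | rfl) hwv
        · exact absurd (.inr (hxp.eq hwv.symm hxu)) hw
        · exact absurd (.inl (hup.eq hwv.symm hxu.symm)) hw
      · exact key u huW hup
    · obtain ⟨y, hy, hyx, huy⟩ := hW.2 huW hx hxu.symm
      by_cases hyp : G.IsPendant y
      · exact ⟨{x, y}, Set.pair_subset hx hy, isFort_pair_of_twins hxp hyp hyx.symm hxu.symm huy,
          Set.ncard_pair hyx.symm⟩
      · exact key y hy hyp
  · exact key x hx hxp

/-- In a tree with at least three vertices, a fort with at most two elements consists of twin
leaves. -/
theorem IsTree.exists_twins_mem_of_isFort [Finite V] {G : SimpleGraph V} (hT : G.IsTree) {b : V}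
    (hb : G.HasDoublePendant b) {F : Set V} (hF : G.IsFort F) (hcard : F.ncard ≤ 2) :
    ∃ w x y, x ≠ y ∧ G.IsPendant x ∧ G.IsPendant y ∧ G.Adj w x ∧ G.Adj w y ∧ x ∈ F ∧ y ∈ F := by
  obtain ⟨c, c', hcc, -, -, hbc, hbc'⟩ := hb
  have hall : ∀ x ∈ F, ∀ y ∈ F, x ≠ y → ∀ w ∈ F, w = x ∨ w = y := by
    intro x hx y hy hxy w hw
    by_contra! hcon
    have := length_le_ncard_of_nodup (F := F) (L := [x, y, w])
      (by simp; grind) (by simp; grind)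
    simp at this
    omega
  have hpend : ∀ x ∈ F, ∀ y ∈ F, x ≠ y → ∀ u, G.Adj x u → G.Adj u y → G.IsPendant x := by
    intro x hx y hy hxy u hxu huy
    refine isPendant_of_forall_eq hxu fun w hw => ?_
    have hwF : w ∉ F := by
      intro hwF
      obtain rfl | rfl := hall x hx y hy hxy w hwF
      · exact hw.ne rfl
      · exact hT.not_adj_of_adj_adj hxu huy hw
    obtain ⟨y', hy', hyx', hwy⟩ := hF.2 hwF hx hw.symm
    obtain rfl := (hall x hx y hy hxy y' hy').resolve_left hyx'
    exact hT.eq_of_adj_adj hxy hw hwy hxu huy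
  obtain ⟨x, hx⟩ := hF.1
  have : Nontrivial V := ⟨c, c', hcc⟩
  obtain ⟨u, hxu⟩ := hT.1.preconnected.exists_adj_of_nontrivial x
  by_cases huF : u ∈ F
  · exfalso
    have hclosed : ∀ x ∈ F, ∀ u ∈ F, G.Adj x u → ∀ w, G.Adj x w → w ∈ F := by
      intro x hx u hu hxu w hw
      by_contra hwF
      obtain ⟨y, hy, hyx, hwy⟩ := hF.2 hwF hx hw.symm
      obtain rfl := (hall x hx u hu hxu.ne y hy).resolve_left hyx
      exact hT.not_adj_of_adj_adj hw hwy hxu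
    have huniv : ∀ v, v ∈ F := by
      refine hT.1.mem_of_closed hx fun v hv w hw => ?_
      obtain rfl | rfl := hall x hx u huF hxu.ne v hv
      · exact hclosed _ hx _ huF hxu w hw
      · exact hclosed _ huF _ hx hxu.symm w hw
    obtain h | h := hall c (huniv c) c' (huniv c') hcc b (huniv b)
    exacts [hbc.ne h, hbc'.ne h]
  · obtain ⟨y, hy, hyx, huy⟩ := hF.2 huF hx hxu.symm
    exact ⟨u, x, y, hyx.symm, hpend x hx y hy hyx.symm u hxu huy,
      hpend y hy x hx hyx u huy.symm hxu.symm, hxu.symm, huy, hx, hy⟩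

theorem IsTree.isLeafy_of_hasDoublePendant [Finite V] {G : SimpleGraph V} (hT : G.IsTree)
    (hW : ∀ W, Minimal G.IsFort W → ∀ W', G.IsFort W' → W.ncard ≤ W'.ncard)
    {b₀ : V} (hb₀ : G.HasDoublePendant b₀) : G.IsLeafy := by
  by_contra hleafy
  rw [IsLeafy] at hleafy
  push Not at hleafy
  obtain ⟨v, hvp, hv⟩ := hleafy
  have hf : ∀ b, ∃ l, G.HasDoublePendant b → G.IsPendant l ∧ G.Adj b l := by
    intro b
    by_cases hb : G.HasDoublePendant b
    · obtain ⟨l, -, -, hl, -, hbl, -⟩ := id hb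
      exact ⟨l, fun _ => ⟨hl, hbl⟩⟩
    · exact ⟨b, fun h => absurd h hb⟩
  choose f hf using hf
  -- The leaf `f b` is put back only where `b` keeps another neighbour: otherwise it would be the
  -- only neighbour of `b` in `W`.
  set W : Set V := {x | (¬ G.HasDoublePendant x ∧
      ¬ ∃ b, G.HasDoublePendant b ∧ G.Adj b x ∧ G.IsPendant x) ∨
    ∃ b, G.HasDoublePendant b ∧
      (∃ y, G.Adj b y ∧ ¬ G.HasDoublePendant y ∧ ¬ G.IsPendant y) ∧ x = f b} with hWdef
  have hWfort : G.IsFort W := by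
    refine ⟨⟨v, .inl ⟨hv, fun ⟨_, _, _, h⟩ => hvp h⟩⟩, fun u x hu hx hux => ?_⟩
    by_cases hub : G.HasDoublePendant u
    · obtain ⟨hxb, hx⟩ | ⟨b, hb, hy, rfl⟩ := hx
      · have hxp : ¬ G.IsPendant x := fun h => hx ⟨u, hub, hux, h⟩
        exact ⟨f u, .inr ⟨u, hub, ⟨x, hux, hxb, hxp⟩, rfl⟩, fun h => hxp (h ▸ (hf u hub).1),
          (hf u hub).2⟩
      · obtain rfl := (hf b hb).1.eq hux.symm (hf b hb).2.symm
        obtain ⟨y, hby, hyb, hyp⟩ := hy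
        exact ⟨y, .inl ⟨hyb, fun ⟨_, _, _, h⟩ => hyp h⟩, fun h => hyp (h ▸ (hf u hb).1), hby⟩
    · exfalso
      have hu' : ∃ b, G.HasDoublePendant b ∧ G.Adj b u ∧ G.IsPendant u := by
        by_contra h
        exact hu (.inl ⟨hub, h⟩)
      obtain ⟨b, hb, hbu, hup⟩ := hu'
      obtain rfl := hup.eq hux hbu.symm
      obtain ⟨h, -⟩ | ⟨b', hb', -, rfl⟩ := hx
      · exact h hb
      · exact hb.not_isPendant (hf b' hb').1
  obtain ⟨F, hFW, hF⟩ := hWfort.exists_minimal_subset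
  have hcard : F.ncard ≤ 2 := by
    obtain ⟨c, c', hcc, hc, hc', hbc, hbc'⟩ := id hb₀
    exact (hW F hF _ (isFort_pair_of_twins hc hc' hcc hbc hbc')).trans (Set.ncard_pair hcc).le
  obtain ⟨w, x, y, hxy, hx, hy, hwx, hwy, hxF, hyF⟩ :=
    hT.exists_twins_mem_of_isFort hb₀ hF.1 hcard
  have hw : G.HasDoublePendant w := ⟨x, y, hxy, hx, hy, hwx, hwy⟩
  have key : ∀ x, G.IsPendant x → G.Adj w x → x ∈ F → x = f w := by
    intro x hx hwx hxF
    obtain ⟨-, h⟩ | ⟨b, hb, -, rfl⟩ := hFW hxF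
    · exact absurd ⟨w, hw, hwx, hx⟩ h
    · rw [hx.eq hwx.symm (hf b hb).2.symm]
  exact hxy ((key x hx hwx hxF).trans (key y hy hwy hyF).symm)

/-! ### Trees without twin leaves -/

/-- A vertex farthest from the root is pendant. -/
theorem IsTree.isPendant_of_forall_dist_le {G : SimpleGraph V} (hT : G.IsTree) {r x : V}
    (hxr : x ≠ r) (hx : ∀ v, G.dist r v ≤ G.dist r x) : G.IsPendant x := by
  obtain ⟨p, hp⟩ := hT.1.exists_isParent hxr
  refine isPendant_of_forall_eq hp.1.symm fun w hw => ?_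
  by_contra hwp
  have := (hp.child hT hw hwp).2
  have := hx w
  omega

theorem IsTree.iso_of_forall_not_hasDoublePendant [Finite V] {G : SimpleGraph V} (hT : G.IsTree)
    (hG : ∀ w, ¬ G.HasDoublePendant w)
    (hW : ∀ W, Minimal G.IsFort W → ∀ W', G.IsFort W' → W.ncard ≤ W'.ncard) :
    (∃ n : ℕ, (n ≤ 4 ∨ n = 6) ∧ Nonempty (G ≃g pathGraph n)) ∨ Nonempty (G ≃g star222) := by
  have := hT.1.nonempty
  obtain ⟨r₀⟩ := id this
  -- The root `r` is itself chosen farthest from some vertex, so that it is pendant.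
  obtain ⟨r, hr⟩ := Finite.exists_max fun v => G.dist r₀ v
  by_cases hrr : r = r₀
  · -- all vertices are at distance zero from `r`
    subst hrr
    have hall : ∀ v, v = r := by
      intro v
      have h := hr v
      rw [dist_self, Nat.le_zero, hT.1.dist_eq_zero_iff] at h
      exact h.symm
    refine .inl ⟨1, by norm_num, hT.1.nonempty_iso (f := fun _ => r)
      (Function.injective_of_subsingleton _) ?_ ?_⟩
    · intro i j h
      exact absurd (Subsingleton.elim i j) h.ne
    · intro i w h
      exact absurd (hall w).symm h.ne
  have hrp := hT.isPendant_of_forall_dist_le hrr hr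
  obtain ⟨x₁, hx₁⟩ := Finite.exists_max fun v => G.dist r v
  have hx₁r : x₁ ≠ r := by
    rintro rfl
    have h := hx₁ r₀
    rw [dist_self, Nat.le_zero, hT.1.dist_eq_zero_iff] at h
    exact hrr h
  have hdeep : ∀ v, G.dist r v = G.dist r x₁ → G.IsPendant v := by
    intro v hv
    refine hT.isPendant_of_forall_dist_le ?_ fun w => hv ▸ hx₁ w
    rintro rfl
    rw [dist_self, eq_comm, hT.1.dist_eq_zero_iff] at hv
    exact hx₁r hv.symm
  have h₁ := hdeep x₁ rfl
  obtain ⟨x₂, hx₂⟩ := hT.1.exists_isParent hx₁r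
  by_cases hx₂r : x₂ = r
  · subst hx₂r
    refine .inl ⟨2, by norm_num, hT.1.nonempty_iso (f := ![x₂, x₁]) ?_ ?_ ?_⟩
    · rw [← List.nodup_ofFn]
      simpa using hx₁r.symm
    · intro i j
      have := hx₂.1
      have := hx₂.1.symm
      rw [pathGraph_adj]
      fin_cases i <;> fin_cases j <;> simp <;> assumption
    · intro i w hw
      simp_rw [pathGraph_adj]
      fin_cases i
      · exact ⟨1, by simp, hrp.eq hx₂.1 hw⟩
      · exact ⟨0, by simp, h₁.eq hx₂.1.symm hw⟩
  obtain ⟨x₃, hx₃⟩ := hT.1.exists_isParent hx₂r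
  have h₁₃ : x₁ ≠ x₃ := by
    rintro rfl
    have := hx₂.2
    have := hx₃.2
    omega
  -- A vertex one level above the deepest one has at most one child, and that child is pendant.
  have hchild : ∀ {p v l l'}, G.IsParent r p v → G.dist r v + 1 = G.dist r x₁ → G.Adj v l →
      l ≠ p → G.Adj v l' → l' ≠ p → G.IsPendant l ∧ l' = l := by
    intro p v l l' hv hdist hl hlp hl' hlp'
    have hlpend := hdeep l ((hv.child hT hl hlp).2.trans hdist)
    have hlpend' := hdeep l' ((hv.child hT hl' hlp').2.trans hdist)
    refine ⟨hlpend, ?_⟩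
    by_contra hne
    exact hG v ⟨l', l, hne, hlpend', hlpend, hl', hl⟩
  have h₂ : ∀ w, G.Adj x₂ w → w = x₁ ∨ w = x₃ := by
    intro w hw
    by_contra! hcon
    exact hcon.1 (hchild hx₃ hx₂.2.symm hx₂.1 h₁₃ hw hcon.2).2
  have hx₃r : x₃ ≠ r := by
    rintro rfl
    exact hG x₂ ⟨x₁, x₃, h₁₃, h₁, hrp, hx₂.1, hx₃.1.symm⟩
  have h₁₂ := hx₂.1.symm
  have h₂₃ := hx₃.1.symm
  have hp₂ : ¬ G.IsPendant x₂ := fun h => h₁₃ (h.eq h₁₂.symm h₂₃)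
  by_cases hl : ∃ l, G.Adj x₃ l ∧ G.IsPendant l
  · obtain ⟨l, h₃l, hl⟩ := hl
    exact .inl ⟨4, by norm_num,
      hT.nonempty_iso_pathGraph_four hG hW h₁ h₁₂ h₂₃ h₁₃ h₂ hl h₃l⟩
  push Not at hl
  obtain ⟨x₄, hx₄⟩ := hT.1.exists_isParent hx₃r
  have h₂₄ : x₂ ≠ x₄ := by
    rintro rfl
    have := hx₄.2
    have := hx₃.2
    omega
  by_cases hy : ∃ y₂, G.Adj x₃ y₂ ∧ y₂ ≠ x₂ ∧ y₂ ≠ x₄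
  · obtain ⟨y₂, hy₂, hyx, hy₄⟩ := hy
    have hpar := hx₄.child hT hy₂ hy₄
    have hdist : G.dist r y₂ + 1 = G.dist r x₁ := by
      rw [hpar.2, hx₂.2, hx₃.2]
    obtain ⟨y₁, hy₁, hy₁₃⟩ := exists_adj_ne_of_not_isPendant (hl _ hy₂) hy₂.symm
    refine .inr (hT.nonempty_iso_star222 hG hW h₁ h₁₂ h₂₃ h₁₃ h₂
      (hchild hpar hdist hy₁ hy₁₃ hy₁ hy₁₃).1 hy₁.symm hy₂.symm hy₁₃ ?_ hyx.symm hl)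
    intro w hw
    by_contra! hcon
    exact hcon.1 (hchild hpar hdist hy₁ hy₁₃ hw hcon.2).2
  · push Not at hy
    exact .inl ⟨6, by norm_num, hT.nonempty_iso_pathGraph_six hG hW h₁ h₁₂ h₂₃ hx₄.1.symm h₁₃ h₂₄
      h₂ (fun w hw => or_iff_not_imp_left.mpr (hy w hw)) (hl _ hx₄.1.symm)⟩

end SimpleGraph

theorem theorem3p12 {V : Type*} [Finite V] (T : SimpleGraph V) (hT : T.IsTree) :
    T.IsWellFailed ↔
      (∃ n : ℕ, (n ≤ 4 ∨ n = 6) ∧ Nonempty (T ≃g SimpleGraph.pathGraph n)) ∨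
      Nonempty (T ≃g SimpleGraph.star222) ∨
      T.IsLeafy := by
  have : Nonempty V := hT.1.nonempty
  constructor
  · intro h
    rw [SimpleGraph.isWellFailed_iff] at h
    by_cases hG : ∃ w, T.HasDoublePendant w
    · obtain ⟨w, hw⟩ := hG
      exact .inr (.inr (hT.isLeafy_of_hasDoublePendant h hw))
    · push Not at hG
      exact (hT.iso_of_forall_not_hasDoublePendant hG h).imp_right .inl
  · rintro (⟨n, hn, ⟨e⟩⟩ | ⟨⟨e⟩⟩ | h)
    · exact SimpleGraph.isWellFailed_of_iso_pathGraph hn e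
    · exact SimpleGraph.isWellFailed_of_iso_star222 e
    · exact h.isWellFailed
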